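/- Let $X$ be the Cantor space (a nonempty compact metrizable totally disconnected space without isolated points), and equip the group $\mathrm{Homeo}(X)$ of homeomorphisms of $X$ with the compact-open topology. For a subgroup $\Gamma\le\mathrm{Homeo}(X)$, let $R_\Gamma$ be the equivalence relation on $X$ whose classes are the $\Gamma$-orbits, let $[R_\Gamma]=\{g\in\mathrm{Homeo}(X):\ g(x)\,R_\Gamma\,x\ \text{for all }x\in X\}$ be its full group, and let $M(\Gamma)$ be the set of all $\Gamma$-invariant Borel probability measures on $X$. Say that $\Gamma$ acts minimally if all its orbits are dense. Say that $\Gamma$ is ample if it is countable and locally finite, the set $\{x\in X:\gamma(x)=x\}$ is clopen for every $\gamma\in\Gamma$, and $\Gamma$ is a full group, i.e. every $g\in\mathrm{Homeo}(X)$ for which there is a finite set $A\subseteq\Gamma$ such that for each $x\in X$ one has $g(x)=\gamma(x)$ for some $\gamma\in A$ belongs to $\Gamma$. Say that an ample group $\Gamma$ is saturated if $\overline{\Gamma}=\overline{[R_\Gamma]}$ in $\mathrm{Homeo}(X)$. Let $\Gamma,\Lambda\le\mathrm{Homeo}(X)$ be two saturated ample groups acting minimally. Then the following conditions are equivalent: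 1. $\Gamma$ and $\Lambda$ are orbit equivalent, i.e. there exists $g\in\mathrm{Homeo}(X)$ such that for all $x,x'\in X$: $x\,R_\Gamma\,x'$ if and only if $g(x)\,R_\Lambda\,g(x')$. 2. There exists $g\in\mathrm{Homeo}(X)$ such that $g_*M(\Gamma)=M(\Lambda)$, where $g_*M(\Gamma)=\{g_*\mu:\mu\in M(\Gamma)\}$. Moreover, these conditions hold if and only if $\Gamma$ and $\Lambda$ are conjugate in $\mathrm{Homeo}(X)$, i.e. $g\Gamma g^{-1}=\Lambda$ for some $g\in\mathrm{Homeo}(X)$. -/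

import Mathlib

open MeasureTheory Set

/-- The topology of `Homeo(X)`: the compact-open topology, i.e. the topology induced by the inclusion
of `Homeo(X)` into the space `C(X, X)` with the compact-open topology. (For `X` the Cantor space,
this is the usual Polish group topology of `Homeo(X)`.) -/
instance homeoTopology (X : Type*) [TopologicalSpace X] : TopologicalSpace (X ≃ₜ X) :=
  TopologicalSpace.induced (fun g : X ≃ₜ X => (ContinuousMap.mk g g.continuous : C(X, X)))
    ContinuousMap.compactOpen

/-- The equivalence relation `R_Γ` induced by the action of `Γ ≤ Homeo(X)` on `X`:
`x R_Γ y` iff `γ x = y` for some `γ ∈ Γ`. -/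
def orbitEquivRel {X : Type*} [TopologicalSpace X] (Γ : Subgroup (X ≃ₜ X)) : Setoid X where
  r x y := ∃ γ ∈ Γ, γ x = y
  iseqv :=
    { refl := fun x => ⟨1, Γ.one_mem, rfl⟩
      symm := by
        rintro x y ⟨γ, hγ, rfl⟩
        exact ⟨γ⁻¹, Γ.inv_mem hγ, γ.symm_apply_apply x⟩
      trans := by
        rintro x y z ⟨γ, hγ, rfl⟩ ⟨δ, hδ, rfl⟩
        exact ⟨δ * γ, Γ.mul_mem hδ hγ, rfl⟩ }

/-- The full group `[R]` of an equivalence relation `R` on `X`. -/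
def fullGroupOfRel {X : Type*} [TopologicalSpace X] (R : Setoid X) : Set (X ≃ₜ X) :=
  {g | ∀ x, R (g x) x}

/-- The topological full group `F(Γ)`: the homeomorphisms obtained by gluing together finitely many
elements of `Γ`. -/
def topologicalFullGroup {X : Type*} [TopologicalSpace X] (Γ : Subgroup (X ≃ₜ X)) :
    Set (X ≃ₜ X) :=
  {g | ∃ A : Finset (X ≃ₜ X), (A : Set (X ≃ₜ X)) ⊆ Γ ∧ ∀ x, ∃ γ ∈ A, g x = γ x}

/-- `Γ` is a full group if `Γ = F(Γ)`. -/
def IsFullGroup {X : Type*} [TopologicalSpace X] (Γ : Subgroup (X ≃ₜ X)) : Prop :=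
  (Γ : Set (X ≃ₜ X)) = topologicalFullGroup Γ

/-- A subgroup is locally finite if every finite subset of it generates a finite group. -/
def IsLocallyFiniteSubgroup {G : Type*} [Group G] (Γ : Subgroup G) : Prop :=
  ∀ A : Finset G, (A : Set G) ⊆ Γ → Finite (Subgroup.closure (A : Set G))

/-- Ample groups (in the sense of Krieger). -/
structure IsAmple {X : Type*} [TopologicalSpace X] (Γ : Subgroup (X ≃ₜ X)) : Prop where
  countable : Countable Γ
  locallyFinite : IsLocallyFiniteSubgroup Γ
  full : IsFullGroup Γ
  isClopen_fixed : ∀ γ ∈ Γ, IsClopen {x | γ x = x}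

/-- `Γ` acts minimally on `X`: all orbits are dense. -/
def ActsMinimally {X : Type*} [TopologicalSpace X] (Γ : Subgroup (X ≃ₜ X)) : Prop :=
  ∀ x, Dense {y | ∃ γ ∈ Γ, γ x = y}

/-- The closure of `Γ` in `Homeo(X)` equals the closure of the full group of the relation `R_Γ`
(an ample group with this property is called saturated). -/
def IsSaturated {X : Type*} [TopologicalSpace X] (Γ : Subgroup (X ≃ₜ X)) : Prop :=
  closure (Γ : Set (X ≃ₜ X)) = closure (fullGroupOfRel (orbitEquivRel Γ))

/-- `Γ` and `Λ` are orbit equivalent: some homeomorphism carries `R_Γ` to `R_Λ`. -/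
def OrbitEquivalent {X : Type*} [TopologicalSpace X] (Γ Λ : Subgroup (X ≃ₜ X)) : Prop :=
  ∃ g : X ≃ₜ X, ∀ x x', (∃ γ ∈ Γ, γ x = x') ↔ (∃ l ∈ Λ, l (g x) = g x')

/-- `Γ` and `Λ` are conjugate in `Homeo(X)`: `g Γ g⁻¹ = Λ` for some homeomorphism `g`. -/
def AreConjugate {X : Type*} [TopologicalSpace X] (Γ Λ : Subgroup (X ≃ₜ X)) : Prop :=
  ∃ g : X ≃ₜ X, Γ.map (MulAut.conj g).toMonoidHom = Λ

/-- `M(Γ)`: the set of `Γ`-invariant Borel probability measures on `X`. -/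
def invariantMeasures {X : Type*} [TopologicalSpace X] [MeasurableSpace X]
    (Γ : Subgroup (X ≃ₜ X)) : Set (Measure X) :=
  {μ | IsProbabilityMeasure μ ∧ ∀ γ ∈ Γ, μ.map γ = μ}

/-!
An orbit equivalence carries invariant measures to invariant measures, because each element of `Λ` is,
after transport, pointwise given by countably many elements of `Γ`
(`map_eq_of_forall_exists_apply_eq`). Conjugate groups are clearly orbit equivalent. The substance is
that equality of the sets of invariant measures forces conjugacy; it has two parts.

*Clopen sets are classified by invariant measures.* If `Γ` is ample, minimal and saturated and clopen
sets `A`, `B` satisfy `μ A = μ B` for all `μ ∈ M(Γ)`, then some `γ ∈ Γ` maps `A` onto `B`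
(`IsSaturated.exists_mem_of_measure_eq`). First, if `μ A < μ B` for every `μ ∈ M(Γ)`, then `A` can be
moved into `B` by `Γ`: a weak limit of uniform measures on orbits of finite subgroups shows that some
finite `H ≤ Γ` has, at every point, at least as many orbit points in `B` as in `A`, and a greedy
matching along the elements of `H` then does the job (`IsAmple.exists_isSwap_of_measure_lt`). With
equal measures one matches all of `A` and `B` except for neighbourhoods shrinking to two points
`x ∈ A`, `y ∈ B` of one orbit; the resulting limit homeomorphism lies in the full group `[R_Γ]`
(`IsAmple.exists_mem_fullGroupOfRel_isSwap`). Saturation replaces it by an element of `Γ`, since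
mapping `A` onto `B` is an open condition.

*Back and forth.* Suppose `g` carries `M(Γ)` to `M(Λ)` and conjugates a finite `H ≤ Γ` into `Λ`. For
finite `K` with `H ≤ K ≤ Γ`, precompose `g` with a small homeomorphism commuting with `H` so that all
of `K` is conjugated into `Λ` (`IsPartialConj.exists_extension`). The correction is built on a fine
clopen partition permuted by `K` so that an element fixing an atom setwise fixes it pointwise: the
classification of clopen sets lets elements of `Λ` imitate those of `K` on the atoms
(`exists_conj_mem_of_equivariant_coloring`). Alternating the roles of `Γ` and `Λ` and passing to the
uniform limit gives a homeomorphism conjugating `Γ` onto `Λ` (`areConjugate_of_isPartialConj`).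
-/

/-! ### Measures on a Cantor space -/

section Measures

variable {X : Type*} [TopologicalSpace X] [MeasurableSpace X] [BorelSpace X]

/-- A homeomorphism that agrees at each point with one of countably many measure-preserving
homeomorphisms preserves the measure: cut `X` along the closed sets where it agrees with each. -/
theorem map_eq_of_forall_exists_apply_eq [T2Space X] {μ : Measure X} {S : Set (X ≃ₜ X)}
    (hS : S.Countable) (hμ : ∀ s ∈ S, μ.map s = μ) (g : X ≃ₜ X) (hg : ∀ x, ∃ s ∈ S, g x = s x) :
    μ.map g = μ := by
  rcases S.eq_empty_or_nonempty with rfl | hne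
  · have : IsEmpty X := ⟨fun x => by simpa using hg x⟩
    exact Subsingleton.elim _ _
  obtain ⟨s, rfl⟩ := hS.exists_eq_range hne
  simp only [mem_range, exists_exists_eq_and, forall_exists_index, forall_apply_eq_imp_iff] at hμ hg
  set F : ℕ → Set X := fun n => {x | g x = s n x} with hF
  have hFm : ∀ n, MeasurableSet (F n) := fun n =>
    (isClosed_eq g.continuous (s n).continuous).measurableSet
  set E := disjointed F with hE
  have hEm : ∀ n, MeasurableSet (E n) := fun n => MeasurableSet.disjointed hFm n
  have hEd : Pairwise (Function.onFun Disjoint E) := disjoint_disjointed F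
  have hEu : ⋃ n, E n = univ := by
    rw [hE, iUnion_disjointed]
    exact eq_univ_of_forall fun x => mem_iUnion.2 (hg x)
  have hgE : ∀ n, MeasurableSet (g '' E n) := fun n =>
    g.measurableEmbedding.measurableSet_image.2 (hEm n)
  ext B hB
  rw [Measure.map_apply g.measurable hB]
  have key : ∀ n, μ (g ⁻¹' B ∩ E n) = μ (B ∩ g '' E n) := by
    intro n
    have h1 : g ⁻¹' B ∩ E n = s n ⁻¹' (B ∩ g '' E n) := by
      ext x
      constructor
      · rintro ⟨hx, hxE⟩
        have : g x = s n x := disjointed_subset F n hxE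
        exact ⟨by rw [← this]; exact hx, x, hxE, this⟩
      · rintro ⟨hx, y, hy, hyx⟩
        have : g y = s n y := disjointed_subset F n hy
        have hxy : y = x := (s n).injective (this.symm.trans hyx)
        subst hxy
        exact ⟨by rw [mem_preimage, this]; exact hx, hy⟩
    rw [h1, ← Measure.map_apply (s n).measurable (hB.inter (hgE n)), hμ n]
  have h1 : μ (g ⁻¹' B) = ∑' n, μ (g ⁻¹' B ∩ E n) := by
    rw [← measure_iUnion (fun i j hij => (hEd hij).mono inter_subset_right inter_subset_right)
      (fun n => (g.measurable hB).inter (hEm n)), ← inter_iUnion, hEu, inter_univ]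
  have h2 : μ B = ∑' n, μ (B ∩ g '' E n) := by
    rw [← measure_iUnion (fun i j hij => Disjoint.mono inter_subset_right inter_subset_right
        ((disjoint_image_iff g.injective).2 (hEd hij)))
      (fun n => hB.inter (hgE n)), ← inter_iUnion, ← image_iUnion, hEu, image_univ,
      g.surjective.range_eq, inter_univ]
  rw [h1, h2]
  exact tsum_congr key

variable [CompactSpace X] [TopologicalSpace.MetrizableSpace X] [TotallyDisconnectedSpace X]

theorem measure_eq_of_forall_isClopen {μ ν : Measure X} [IsFiniteMeasure μ]
    (h : ∀ A, IsClopen A → μ A = ν A) : μ = ν := by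
  let := TopologicalSpace.metrizableSpaceMetric X
  refine ext_of_generate_finite {s : Set X | IsClopen s} ?_ ?_ (fun s hs => h s hs)
    (h _ isClopen_univ)
  · rw [BorelSpace.measurable_eq (α := X)]
    exact (isTopologicalBasis_isClopen (X := X)).borel_eq_generateFrom
  · exact fun s hs t ht _ => hs.inter ht

/-- Compactness: asymptotically invariant probability measures have an invariant limit, and weak
inequalities between the measures of clopen sets pass to it. -/
theorem exists_mem_invariantMeasures_of_seq {Γ : Subgroup (X ≃ₜ X)} (ν : ℕ → ProbabilityMeasure X)
    (hν : ∀ γ ∈ Γ, ∀ᶠ n in Filter.atTop, (ν n : Measure X).map γ = ν n) :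
    ∃ μ ∈ invariantMeasures Γ, ∀ A B, IsClopen A → IsClopen B →
      (∀ n, (ν n : Measure X) B ≤ (ν n : Measure X) A) → μ B ≤ μ A := by
  let := TopologicalSpace.metrizableSpaceMetric X
  let U : Ultrafilter ℕ := Ultrafilter.of Filter.atTop
  have hU : (U : Filter ℕ) ≤ Filter.atTop := Ultrafilter.of_le _
  obtain ⟨μ, -, hμ⟩ := isCompact_univ.ultrafilter_le_nhds (U.map ν) (by simp)
  have hlim : ∀ A, IsClopen A →
      Filter.Tendsto (fun n => (ν n : Measure X) A) U (nhds ((μ : Measure X) A)) := by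
    intro A hA
    exact ProbabilityMeasure.tendsto_measure_of_null_frontier_of_tendsto' (E := A) hμ
      (by simp [hA.frontier_eq])
  refine ⟨μ, ⟨inferInstance, fun γ hγ => ?_⟩, fun A B hA hB h =>
    le_of_tendsto_of_tendsto' (hlim B hB) (hlim A hA) h⟩
  have : IsProbabilityMeasure ((μ : Measure X).map γ) :=
    Measure.isProbabilityMeasure_map γ.measurable.aemeasurable
  refine measure_eq_of_forall_isClopen fun A hA => ?_
  rw [Measure.map_apply γ.measurable hA.isOpen.measurableSet]
  refine tendsto_nhds_unique (hlim _ (hA.preimage γ.continuous)) ?_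
  refine (hlim A hA).congr' ?_
  filter_upwards [hU (hν γ hγ)] with n hn
  conv_lhs => rw [← hn, Measure.map_apply γ.measurable hA.isOpen.measurableSet]

end Measures

/-! ### Swaps of clopen sets -/

section Swaps

variable {X : Type*} [TopologicalSpace X]

/-- `σ` is an involution exchanging `D` and `E` and fixing every point outside `D ∪ E`. The sets are
not required to be disjoint. -/
structure IsSwap (σ : X ≃ₜ X) (D E : Set X) : Prop where
  involutive : ∀ x, σ (σ x) = x
  mapsTo : ∀ x ∈ D, σ x ∈ E
  mapsTo' : ∀ x ∈ E, σ x ∈ D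
  fix : ∀ x, x ∉ D → x ∉ E → σ x = x

theorem isSwap_one : IsSwap (1 : X ≃ₜ X) ∅ ∅ :=
  ⟨fun _ => rfl, by simp, by simp, fun _ _ _ => rfl⟩

theorem IsSwap.symm {σ : X ≃ₜ X} {D E : Set X} (h : IsSwap σ D E) : IsSwap σ E D :=
  ⟨h.involutive, h.mapsTo', h.mapsTo, fun x h1 h2 => h.fix x h2 h1⟩

theorem IsSwap.preimage_eq {σ : X ≃ₜ X} {D E : Set X} (h : IsSwap σ D E) : σ ⁻¹' E = D := by
  ext x
  refine ⟨fun hx => ?_, fun hx => h.mapsTo x hx⟩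
  rw [← h.involutive x]
  exact h.mapsTo' _ hx

theorem IsSwap.union {σ τ : X ≃ₜ X} {D E D' E' : Set X} (h : IsSwap σ D E) (h' : IsSwap τ D' E')
    (hd : Disjoint (D ∪ E) (D' ∪ E')) : IsSwap (σ * τ) (D ∪ D') (E ∪ E') := by
  rw [Set.disjoint_left] at hd
  have h1 := h.mapsTo
  have h2 := h.mapsTo'
  have h3 := h.fix
  have h4 := h'.mapsTo
  have h5 := h'.mapsTo'
  have h6 := h'.fix
  have h7 := h.involutive
  have h8 := h'.involutive
  simp only [mem_union] at hd
  constructor <;> intro x <;> simp only [Homeomorph.mul_apply, mem_union]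
  · by_cases hx : x ∈ D' ∨ x ∈ E'
    · have h9 : τ x ∈ D' ∨ τ x ∈ E' := by grind
      have h10 : σ (τ x) = τ x := by grind
      grind
    · have h9 : τ x = x := by grind
      by_cases hx' : x ∈ D ∨ x ∈ E
      · have h10 : σ x ∈ D ∨ σ x ∈ E := by grind
        have h11 := hd h10
        grind
      · have h10 : σ x = x := by grind
        grind
  all_goals grind

/-- A continuous involution, as a homeomorphism. -/
def Homeomorph.ofInvolutive (f : X → X) (hf : Function.Involutive f) (hc : Continuous f) :
    X ≃ₜ X where
  toEquiv := hf.toPerm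
  continuous_toFun := hc
  continuous_invFun := hc

open Classical in
/-- If `γ` moves `C` off itself, then `γ` on `C` and `γ⁻¹` on its image glue to a swap. -/
theorem exists_isSwap_image (γ : X ≃ₜ X) {C : Set X} (hC : IsClopen C) (hγ : ∀ x ∈ C, γ x ∉ C) :
    ∃ σ : X ≃ₜ X, IsSwap σ C (γ '' C) ∧ ∀ x, σ x = γ x ∨ σ x = γ⁻¹ x ∨ σ x = x := by
  have hγC : IsClopen (γ ⁻¹' C) := hC.preimage γ.continuous
  have hγC' : IsClopen (γ.symm ⁻¹' C) := hC.preimage γ.symm.continuous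
  let f : X → X := fun x => if x ∈ C then γ x else if x ∈ γ.symm ⁻¹' C then γ.symm x else x
  have hf1 : ∀ x ∈ C, f x = γ x := fun x hx => by simp [f, hx]
  have hf2 : ∀ x ∈ C, f (γ x) = x := fun x hx => by simp [f, hx, hγ x hx]
  have hf3 : ∀ x, x ∉ C → γ.symm x ∉ C → f x = x := fun x h1 h2 => by simp [f, h1, h2]
  have hinv : Function.Involutive f := by
    intro x
    by_cases hx : x ∈ C
    · rw [hf1 x hx, hf2 x hx]
    · by_cases hx' : γ.symm x ∈ C
      · have h := hf2 _ hx'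
        rw [γ.apply_symm_apply] at h
        rw [h, hf1 _ hx', γ.apply_symm_apply]
      · rw [hf3 x hx hx', hf3 x hx hx']
  have hcont : Continuous f := by
    refine continuous_if (fun a ha => ?_) γ.continuous.continuousOn
      (continuous_if (fun a ha => ?_) γ.symm.continuous.continuousOn
        continuous_id.continuousOn).continuousOn
    · have : a ∈ frontier C := ha
      simp [hC.frontier_eq] at this
    · have : a ∈ frontier (γ.symm ⁻¹' C) := ha
      simp [hγC'.frontier_eq] at this
  refine ⟨Homeomorph.ofInvolutive f hinv hcont, ⟨hinv, fun x hx => ⟨x, hx, (hf1 x hx).symm⟩, ?_,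
    fun x h1 h2 => hf3 x h1 fun h => h2 ⟨_, h, γ.apply_symm_apply x⟩⟩, fun x => ?_⟩
  · rintro _ ⟨x, hx, rfl⟩
    have h : f (γ x) ∈ C := by rwa [hf2 x hx]
    exact h
  · change f x = _ ∨ f x = γ.symm x ∨ f x = x
    simp only [f]
    split_ifs <;> simp

/-- Greedy matching: run through the elements `h` of the list, each time pairing `x ∈ A` with
`h x ∈ B` whenever both are still unmatched. In the end no element of the list maps an unmatched
point of `A` to an unmatched point of `B`. -/
theorem exists_isSwap_of_list (H : Subgroup (X ≃ₜ X)) (L : List (X ≃ₜ X)) (hL : ∀ h ∈ L, h ∈ H)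
    {A B : Set X} (hA : IsClopen A) (hB : IsClopen B) (hAB : Disjoint A B) :
    ∃ (σ : X ≃ₜ X) (D E : Set X), IsSwap σ D E ∧ D ⊆ A ∧ E ⊆ B ∧ IsClopen D ∧
      (∀ x, ∃ s ∈ H, σ x = s x) ∧ ∀ h ∈ L, ∀ x ∈ A \ D, h x ∉ B \ E := by
  induction L generalizing A B with
  | nil =>
    exact ⟨1, ∅, ∅, isSwap_one, by simp, by simp, isClopen_empty,
      fun x => ⟨1, H.one_mem, rfl⟩, by simp⟩
  | cons h L ih =>
    simp only [List.mem_cons, forall_eq_or_imp] at hL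
    have hC : IsClopen (A ∩ h ⁻¹' B) := hA.inter (hB.preimage h.continuous)
    set C := A ∩ h ⁻¹' B with hCdef
    have hhC : IsClopen (h '' C) := ⟨h.isClosed_image.2 hC.1, h.isOpen_image.2 hC.2⟩
    have hCB : h '' C ⊆ B := by rintro _ ⟨x, hx, rfl⟩; exact hx.2
    have hCA : C ⊆ A := inter_subset_left
    obtain ⟨τ, hτ, hτH⟩ := exists_isSwap_image h hC
      (fun x hx hx' => Set.disjoint_left.1 hAB (hCA hx') hx.2)
    obtain ⟨σ, D, E, hσ, hD, hE, hDc, hσH, hσL⟩ := ih hL.2 (hA.diff hC) (hB.diff hhC)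
      (hAB.mono sdiff_subset sdiff_subset)
    refine ⟨σ * τ, D ∪ C, E ∪ h '' C, hσ.union hτ ?_, ?_, ?_, hDc.union hC, ?_, ?_⟩
    · rw [Set.disjoint_left] at hAB ⊢
      rintro x (hx | hx) (hx' | hx')
      · exact (hD hx).2 hx'
      · exact hAB (hD hx).1 (hCB hx')
      · exact hAB (hCA hx') (hE hx).1
      · exact (hE hx).2 hx'
    · exact union_subset (hD.trans sdiff_subset) hCA
    · exact union_subset (hE.trans sdiff_subset) hCB
    · intro x
      obtain ⟨s, hs, hsx⟩ := hσH (τ x)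
      rcases hτH x with h1 | h1 | h1
      · exact ⟨s * h, H.mul_mem hs hL.1, by rw [Homeomorph.mul_apply, hsx, h1]; rfl⟩
      · exact ⟨s * h⁻¹, H.mul_mem hs (H.inv_mem hL.1), by rw [Homeomorph.mul_apply, hsx, h1]; rfl⟩
      · exact ⟨s, hs, by rw [Homeomorph.mul_apply, hsx, h1]⟩
    · simp only [List.mem_cons, forall_eq_or_imp]
      refine ⟨fun x hx hx' => hx.2 (Or.inr ⟨hx.1, hx'.1⟩), fun l hl x hx hx' => ?_⟩
      exact hσL l hl x ⟨⟨hx.1, fun h => hx.2 (Or.inr h)⟩, fun h => hx.2 (Or.inl h)⟩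
        ⟨⟨hx'.1, fun h => hx'.2 (Or.inr h)⟩, fun h => hx'.2 (Or.inl h)⟩

theorem IsFullGroup.mem_of_forall_exists {Γ H : Subgroup (X ≃ₜ X)} (hΓ : IsFullGroup Γ)
    (hHΓ : H ≤ Γ) [Finite H] {σ : X ≃ₜ X} (hσ : ∀ x, ∃ s ∈ H, σ x = s x) : σ ∈ Γ := by
  have hf : (H : Set (X ≃ₜ X)).Finite := Set.toFinite _
  have h : σ ∈ topologicalFullGroup Γ := by
    refine ⟨hf.toFinset, ?_, fun x => ?_⟩
    · simpa using hHΓ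
    · obtain ⟨s, hs, hsx⟩ := hσ x
      exact ⟨s, by simpa using hs, hsx⟩
  rw [← hΓ] at h
  exact h

end Swaps

/-! ### Exhaustion by finite subgroups -/

section Exhaustion

theorem IsLocallyFiniteSubgroup.exists_exhaustion {G : Type*} [Group G] {Γ : Subgroup G}
    (hc : Countable Γ) (hf : IsLocallyFiniteSubgroup Γ) :
    ∃ H : ℕ → Subgroup G, Monotone H ∧ (∀ n, Finite (H n)) ∧ (∀ n, H n ≤ Γ) ∧
      ∀ γ ∈ Γ, ∃ n, γ ∈ H n := by
  classical
  obtain ⟨e, he⟩ := exists_surjective_nat Γ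
  refine ⟨fun n => Subgroup.closure
    (((Finset.range (n + 1)).image fun i => (e i : G) : Finset G) : Set G), ?_, ?_, ?_, ?_⟩
  · intro m n hmn
    refine Subgroup.closure_mono ?_
    rw [Finset.coe_subset]
    exact Finset.image_subset_image (Finset.range_subset_range.2 (by omega))
  · intro n
    refine hf _ ?_
    intro x hx
    simp only [Finset.coe_image, mem_image] at hx
    obtain ⟨i, -, rfl⟩ := hx
    exact (e i).2
  · intro n
    rw [Subgroup.closure_le]
    intro x hx
    simp only [Finset.coe_image, mem_image] at hx
    obtain ⟨i, -, rfl⟩ := hx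
    exact (e i).2
  · intro γ hγ
    obtain ⟨n, hn⟩ := he ⟨γ, hγ⟩
    refine ⟨n, Subgroup.subset_closure ?_⟩
    simp only [Finset.coe_image, mem_image]
    exact ⟨n, by simp, by rw [hn]⟩

end Exhaustion

/-! ### Comparison of clopen sets by invariant measures -/

section Comparison

variable {X : Type*} [TopologicalSpace X] [MeasurableSpace X]

/-- The average of the Dirac masses at `h x`, for `h ∈ H`: the uniform probability measure on the
`H`-orbit of `x` when `H` is finite. -/
noncomputable def orbitMeasure (H : Subgroup (X ≃ₜ X)) (x : X) : Measure X :=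
  (Nat.card H : ENNReal)⁻¹ • Measure.sum fun h : H => Measure.dirac ((h : X ≃ₜ X) x)

theorem isProbabilityMeasure_orbitMeasure (H : Subgroup (X ≃ₜ X)) [Finite H] (x : X) :
    IsProbabilityMeasure (orbitMeasure H x) := by
  have := Fintype.ofFinite H
  constructor
  rw [orbitMeasure, Measure.smul_apply, Measure.sum_apply _ MeasurableSet.univ, tsum_fintype]
  simp only [measure_univ, Finset.sum_const, Finset.card_univ, nsmul_eq_mul, mul_one, smul_eq_mul,
    Nat.card_eq_fintype_card]
  exact ENNReal.inv_mul_cancel (by simp) (by simp)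

theorem orbitMeasure_pos (H : Subgroup (X ≃ₜ X)) [Finite H] {x : X} {A : Set X}
    (hx : x ∈ A) : 0 < orbitMeasure H x A := by
  rw [orbitMeasure, Measure.smul_apply, smul_eq_mul]
  refine ENNReal.mul_pos (by simp) (ne_of_gt (lt_of_lt_of_le ?_ (Measure.le_sum_apply _ _)))
  refine lt_of_lt_of_le ?_ (ENNReal.le_tsum (1 : H))
  refine lt_of_lt_of_le zero_lt_one ?_
  refine le_trans ?_ Measure.le_dirac_apply
  simp [indicator, hx]

theorem orbitMeasure_eq_zero (H : Subgroup (X ≃ₜ X)) {x : X} {A : Set X}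
    (hA : MeasurableSet A) (h : ∀ γ ∈ H, γ x ∉ A) : orbitMeasure H x A = 0 := by
  rw [orbitMeasure, Measure.smul_apply, Measure.sum_apply _ hA]
  simp [Measure.dirac_apply' _ hA, indicator, h]

variable [BorelSpace X]

theorem map_orbitMeasure (H : Subgroup (X ≃ₜ X)) (x : X) {γ : X ≃ₜ X} (hγ : γ ∈ H) :
    (orbitMeasure H x).map γ = orbitMeasure H x := by
  ext A hA
  rw [Measure.map_apply γ.measurable hA, orbitMeasure, Measure.smul_apply, Measure.smul_apply,
    Measure.sum_apply _ hA, Measure.sum_apply _ (γ.measurable hA)]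
  congr 1
  conv_rhs => rw [← (Equiv.mulLeft (⟨γ, hγ⟩ : H)).tsum_eq]
  refine tsum_congr fun h => ?_
  rw [Measure.dirac_apply' _ hA, Measure.dirac_apply' _ (γ.measurable hA)]
  rfl

/-- If every `H`-orbit meets `B` at least as often as `A`, the greedy matching exhausts `A`: an
unmatched point of `A` would have no unmatched point of `B` in its orbit, while matched points occur
in equal numbers. -/
theorem exists_isSwap_of_orbitMeasure_le [T2Space X] {Γ H : Subgroup (X ≃ₜ X)} (hΓ : IsFullGroup Γ)
    (hHΓ : H ≤ Γ) [Finite H] {A B : Set X} (hA : IsClopen A) (hB : IsClopen B)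
    (hAB : Disjoint A B) (hle : ∀ x, orbitMeasure H x A ≤ orbitMeasure H x B) :
    ∃ σ ∈ Γ, ∃ E ⊆ B, IsSwap σ A E := by
  have hf : (H : Set (X ≃ₜ X)).Finite := Set.toFinite _
  obtain ⟨σ, D, E, hσ, hD, hE, hDc, hσH, hL⟩ := exists_isSwap_of_list H hf.toFinset.toList
    (fun h hh => by simpa using hh) hA hB hAB
  have hEc : IsClopen E := by
    rw [← hσ.symm.preimage_eq]
    exact hDc.preimage σ.continuous
  have hDA : D = A := by
    refine hD.antisymm fun x hxA => ?_
    by_contra hxD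
    have := isProbabilityMeasure_orbitMeasure H x
    have h1 : orbitMeasure H x D = orbitMeasure H x E := by
      have h2 : (orbitMeasure H x).map σ = orbitMeasure H x :=
        map_eq_of_forall_exists_apply_eq hf.countable (fun s hs => map_orbitMeasure H x hs) σ hσH
      conv_rhs => rw [← h2, Measure.map_apply σ.measurable hEc.isOpen.measurableSet,
        hσ.preimage_eq]
    have h2 : orbitMeasure H x (B \ E) = 0 :=
      orbitMeasure_eq_zero H (hB.diff hEc).isOpen.measurableSet
        fun γ hγ => hL γ (by simpa using hγ) x ⟨hxA, hxD⟩
    have h3 : 0 < orbitMeasure H x (A \ D) := orbitMeasure_pos H (show x ∈ A \ D from ⟨hxA, hxD⟩)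
    have h4 := hle x
    rw [← measure_inter_add_sdiff A hDc.isOpen.measurableSet,
      ← measure_inter_add_sdiff B hEc.isOpen.measurableSet, inter_eq_self_of_subset_right hD,
      inter_eq_self_of_subset_right hE, h1, h2] at h4
    rw [ENNReal.add_le_add_iff_left (measure_ne_top _ _)] at h4
    exact absurd h4 (not_le.2 h3)
  subst hDA
  exact ⟨σ, hΓ.mem_of_forall_exists hHΓ hσH, E, hE, hσ⟩

variable [CompactSpace X] [TopologicalSpace.MetrizableSpace X] [TotallyDisconnectedSpace X]

/-- Otherwise orbit measures of an exhausting sequence of finite subgroups would converge to an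
invariant measure `μ` with `μ B ≤ μ A`. -/
theorem exists_finite_subgroup_orbitMeasure_le {Γ : Subgroup (X ≃ₜ X)} (hc : Countable Γ)
    (hlf : IsLocallyFiniteSubgroup Γ) {A B : Set X} (hA : IsClopen A) (hB : IsClopen B)
    (hlt : ∀ μ ∈ invariantMeasures Γ, μ A < μ B) :
    ∃ H ≤ Γ, Finite H ∧ ∀ x, orbitMeasure H x A ≤ orbitMeasure H x B := by
  obtain ⟨H, hmono, hfin, hle, hex⟩ := hlf.exists_exhaustion hc
  by_contra! hcon
  choose x hx using fun n => hcon (H n) (hle n) (hfin n)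
  obtain ⟨μ, hμ, hμ'⟩ := exists_mem_invariantMeasures_of_seq (Γ := Γ)
    (fun n => ⟨orbitMeasure (H n) (x n), isProbabilityMeasure_orbitMeasure _ _⟩) (by
      intro γ hγ
      obtain ⟨n, hn⟩ := hex γ hγ
      filter_upwards [Filter.eventually_ge_atTop n] with m hm
      exact map_orbitMeasure _ _ (hmono hm hn))
  exact absurd (hlt μ hμ) (not_lt.2 (hμ' A B hA hB fun n => (hx n).le))

theorem IsAmple.exists_isSwap_of_measure_lt {Γ : Subgroup (X ≃ₜ X)} (hΓ : IsAmple Γ) {A B : Set X}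
    (hA : IsClopen A) (hB : IsClopen B) (hAB : Disjoint A B)
    (hlt : ∀ μ ∈ invariantMeasures Γ, μ A < μ B) : ∃ σ ∈ Γ, ∃ E ⊆ B, IsSwap σ A E := by
  obtain ⟨H, hH, hfin, hle⟩ :=
    exists_finite_subgroup_orbitMeasure_le hΓ.countable hΓ.locallyFinite hA hB hlt
  exact exists_isSwap_of_orbitMeasure_le hΓ.full hH hA hB hAB hle

theorem IsAmple.invariantMeasures_nonempty [Nonempty X] {Γ : Subgroup (X ≃ₜ X)}
    (hΓ : IsAmple Γ) : (invariantMeasures Γ).Nonempty := by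
  by_contra hne
  rw [Set.not_nonempty_iff_eq_empty] at hne
  obtain ⟨H, -, hfin, hle⟩ := exists_finite_subgroup_orbitMeasure_le (Γ := Γ) hΓ.countable
    hΓ.locallyFinite isClopen_univ isClopen_empty (by simp [hne])
  obtain ⟨x⟩ := ‹Nonempty X›
  have := hle x
  rw [measure_empty] at this
  exact absurd this (not_le.2 (orbitMeasure_pos H (mem_univ x)))

end Comparison

/-! ### Measures of small and large sets under a minimal action -/

section Bounds

variable {X : Type*} [TopologicalSpace X] [MeasurableSpace X] [BorelSpace X]

theorem measure_preimage_of_mem_invariantMeasures {Γ : Subgroup (X ≃ₜ X)} {μ : Measure X}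
    (hμ : μ ∈ invariantMeasures Γ) {γ : X ≃ₜ X} (hγ : γ ∈ Γ) {A : Set X} (hA : MeasurableSet A) :
    μ (γ ⁻¹' A) = μ A := by
  conv_rhs => rw [← hμ.2 γ hγ, Measure.map_apply γ.measurable hA]

theorem IsSwap.measure_eq {Γ : Subgroup (X ≃ₜ X)} {σ : X ≃ₜ X} {D E : Set X} (h : IsSwap σ D E)
    (hσ : σ ∈ Γ) (hE : MeasurableSet E) {μ : Measure X} (hμ : μ ∈ invariantMeasures Γ) :
    μ D = μ E := by
  rw [← h.preimage_eq, measure_preimage_of_mem_invariantMeasures hμ hσ hE]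

/-- Finitely many translates of a nonempty open set cover `X`, so its measure is bounded below
uniformly over the invariant measures. -/
theorem ActsMinimally.exists_le_measure [CompactSpace X] {Γ : Subgroup (X ≃ₜ X)}
    (hΓ : ActsMinimally Γ) {A : Set X} (hA : IsOpen A) (hne : A.Nonempty) :
    ∃ c : ENNReal, c ≠ 0 ∧ ∀ μ ∈ invariantMeasures Γ, c ≤ μ A := by
  obtain ⟨t, ht⟩ := isCompact_univ.elim_finite_subcover (fun γ : Γ => (γ : X ≃ₜ X) ⁻¹' A)
    (fun γ => hA.preimage γ.1.continuous) (fun x _ => by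
      obtain ⟨_, hy, γ, hγ, rfl⟩ := (hΓ x).inter_open_nonempty A hA hne
      exact mem_iUnion.2 ⟨⟨γ, hγ⟩, hy⟩)
  refine ⟨(t.card : ENNReal)⁻¹, by simp, fun μ hμ => ?_⟩
  have := hμ.1
  have h1 : (1 : ENNReal) ≤ t.card * μ A := by
    calc (1 : ENNReal) = μ univ := measure_univ.symm
      _ ≤ μ (⋃ γ ∈ t, (γ : X ≃ₜ X) ⁻¹' A) := measure_mono ht
      _ ≤ ∑ γ ∈ t, μ ((γ : X ≃ₜ X) ⁻¹' A) := measure_biUnion_finset_le _ _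
      _ = t.card * μ A := by
        rw [Finset.sum_congr rfl fun γ _ =>
          measure_preimage_of_mem_invariantMeasures hμ γ.2 hA.measurableSet]
        simp
  rw [mul_comm] at h1
  rw [← one_div]
  exact ENNReal.div_le_of_le_mul h1

/-- Orbits are infinite, so a small neighbourhood of `y` has many disjoint translates, and its measure
is small uniformly over the invariant measures. -/
theorem ActsMinimally.exists_measure_lt [T2Space X] [CompactSpace X] [TotallyDisconnectedSpace X]
    [PerfectSpace X] {Γ : Subgroup (X ≃ₜ X)} (hΓ : ActsMinimally Γ) {y : X} {U : Set X}
    (hU : U ∈ nhds y) {ε : ENNReal} (hε : ε ≠ 0) :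
    ∃ W, IsClopen W ∧ y ∈ W ∧ W ⊆ U ∧ ∀ μ ∈ invariantMeasures Γ, μ W < ε := by
  -- A finite dense orbit would be all of `X`, and `y` would be isolated.
  have hinf : {z | ∃ γ ∈ Γ, γ y = z}.Infinite := by
    intro hfin
    have h1 := hfin.isClosed.closure_eq
    rw [(hΓ y).closure_eq] at h1
    rw [← h1] at hfin
    have : (nhdsWithin y {y}ᶜ).NeBot := perfectSpace_iff_forall_not_isolated.1 ‹_› y
    exact infinite_of_mem_nhds y Filter.univ_mem hfin
  obtain ⟨N, hN⟩ := ENNReal.exists_inv_nat_lt hε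
  obtain ⟨t, ht, rfl⟩ := hinf.exists_subset_card_eq N
  choose! γ hγ hγy using fun z (hz : z ∈ t) => ht hz
  obtain ⟨V, hV, hVd⟩ := t.finite_toSet.t2_separation
  have hnhds : U ∩ ⋂ z ∈ t, γ z ⁻¹' V z ∈ nhds y := by
    refine Filter.inter_mem hU ((Filter.biInter_finset_mem t).2 fun z hz => ?_)
    refine (γ z).continuous.continuousAt.preimage_mem_nhds ?_
    rw [hγy z hz]
    exact (hV z).2.mem_nhds (hV z).1
  obtain ⟨W, hW, hyW, hWU⟩ := compact_exists_isClopen_in_isOpen isOpen_interior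
    (mem_interior_iff_mem_nhds.2 hnhds)
  have hWU' := hWU.trans interior_subset
  refine ⟨W, hW, hyW, hWU'.trans inter_subset_left, fun μ hμ => ?_⟩
  have := hμ.1
  refine lt_of_le_of_lt (ENNReal.le_inv_iff_mul_le.2 ?_) hN
  calc μ W * t.card = ∑ z ∈ t, μ (((γ z)⁻¹ : X ≃ₜ X) ⁻¹' W) := by
        rw [Finset.sum_congr rfl fun z hz => measure_preimage_of_mem_invariantMeasures hμ
          (Γ.inv_mem (hγ z hz)) hW.isOpen.measurableSet]
        simp [mul_comm]
    _ = μ (⋃ z ∈ t, ((γ z)⁻¹ : X ≃ₜ X) ⁻¹' W) := by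
        refine (measure_biUnion_finset ?_ fun z _ =>
          (hW.isOpen.preimage (γ z)⁻¹.continuous).measurableSet).symm
        intro z hz z' hz' hne
        refine (hVd hz hz' hne).mono ?_ ?_
        · intro a ha
          have := mem_iInter₂.1 (hWU' ha).2 z hz
          rwa [mem_preimage, Homeomorph.inv_apply, Homeomorph.apply_symm_apply] at this
        · intro a ha
          have := mem_iInter₂.1 (hWU' ha).2 z' hz'
          rwa [mem_preimage, Homeomorph.inv_apply, Homeomorph.apply_symm_apply] at this
    _ ≤ 1 := prob_le_one

/-- Half a step of the construction below: all of `A` but a small neighbourhood of `x` is matched with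
a part of `B` not containing `y`, leaving remainders of equal measure. -/
theorem IsAmple.exists_isSwap_shrink [CompactSpace X] [TopologicalSpace.MetrizableSpace X]
    [TotallyDisconnectedSpace X] [PerfectSpace X] {Γ : Subgroup (X ≃ₜ X)} (hΓ : IsAmple Γ)
    (hmin : ActsMinimally Γ) {A B : Set X} (hA : IsClopen A) (hB : IsClopen B)
    (hAB : Disjoint A B) (hμ : ∀ μ ∈ invariantMeasures Γ, μ A = μ B) {x y : X} (hx : x ∈ A)
    (hy : y ∈ B) {U : Set X} (hU : U ∈ nhds x) :
    ∃ σ ∈ Γ, ∃ A' B', A' ⊆ A ∧ A' ⊆ U ∧ B' ⊆ B ∧ IsClopen A' ∧ IsClopen B' ∧ x ∈ A' ∧ y ∈ B' ∧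
      (∀ μ ∈ invariantMeasures Γ, μ A' = μ B') ∧ IsSwap σ (A \ A') (B \ B') := by
  obtain ⟨A', hA', hxA', hA'U⟩ := compact_exists_isClopen_in_isOpen (isOpen_interior (s := A ∩ U))
    (mem_interior_iff_mem_nhds.2 (Filter.inter_mem (hA.isOpen.mem_nhds hx) hU))
  replace hA'U := hA'U.trans interior_subset
  have hA'A : A' ⊆ A := hA'U.trans inter_subset_left
  obtain ⟨c, hc, hcA⟩ := hmin.exists_le_measure hA'.isOpen ⟨x, hxA'⟩
  obtain ⟨W, hW, hyW, hWB, hWc⟩ := hmin.exists_measure_lt (hB.isOpen.mem_nhds hy) hc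
  have hlt : ∀ μ ∈ invariantMeasures Γ, μ (A \ A') < μ (B \ W) := by
    intro μ hμΓ
    have := hμΓ.1
    by_contra! hle
    have h1 := hμ μ hμΓ
    rw [← measure_inter_add_sdiff A hA'.isOpen.measurableSet,
      ← measure_inter_add_sdiff B hW.isOpen.measurableSet,
      inter_eq_self_of_subset_right hA'A, inter_eq_self_of_subset_right hWB] at h1
    exact absurd h1 (ne_of_gt (ENNReal.add_lt_add_of_lt_of_le (measure_ne_top _ _)
      ((hWc μ hμΓ).trans_le (hcA μ hμΓ)) hle))
  obtain ⟨σ, hσ, E, hE, hsw⟩ := hΓ.exists_isSwap_of_measure_lt (hA.diff hA') (hB.diff hW)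
    (hAB.mono sdiff_subset sdiff_subset) hlt
  have hEB : E ⊆ B := hE.trans sdiff_subset
  have hEc : IsClopen E := by
    rw [← hsw.symm.preimage_eq]
    exact (hA.diff hA').preimage σ.continuous
  refine ⟨σ, hσ, A', B \ E, hA'A, hA'U.trans inter_subset_right, sdiff_subset, hA', hB.diff hEc,
    hxA', ⟨hy, fun h => (hE h).2 hyW⟩, fun μ hμΓ => ?_, ?_⟩
  · have := hμΓ.1
    have h1 := hμ μ hμΓ
    rw [← measure_inter_add_sdiff A hA'.isOpen.measurableSet,
      ← measure_inter_add_sdiff B hEc.isOpen.measurableSet,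
      inter_eq_self_of_subset_right hA'A, inter_eq_self_of_subset_right hEB,
      hsw.measure_eq hσ hEc.isOpen.measurableSet hμΓ, add_comm] at h1
    exact (ENNReal.add_right_inj (measure_ne_top _ _)).1 h1
  · rwa [sdiff_sdiff_cancel_left hEB]

end Bounds

/-! ### Gluing infinitely many swaps -/

section Gluing

/-- A point that leaves a decreasing sequence of sets lies in one of the successive differences. -/
theorem exists_mem_diff_succ {X : Type*} {A : ℕ → Set X} {z : X} {n k : ℕ} (hn : z ∈ A n) (hk : z ∉ A k)
    (hA : Antitone A) : ∃ m ≥ n, z ∈ A m \ A (m + 1) := by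
  by_contra! hcon
  have h : ∀ m, n ≤ m → z ∈ A m := fun m hm =>
    Nat.le_induction hn (fun m hm ih => by simpa [ih] using hcon m hm) m hm
  exact hk (hA (le_max_right n k) (h _ (le_max_left n k)))

theorem eq_of_mem_diff_succ {X : Type*} {A : ℕ → Set X} (hA : Antitone A) {z : X} {m n : ℕ}
    (hm : z ∈ A m \ A (m + 1)) (hn : z ∈ A n \ A (n + 1)) : m = n := by
  rcases lt_trichotomy m n with h | h | h
  · exact absurd (hA h hn.1) hm.2
  · exact h
  · exact absurd (hA h hm.1) hn.2

variable {X : Type*} [TopologicalSpace X]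

/-- Swaps of the successive differences of two sequences of clopen sets shrinking to `x` and `y` glue
to a homeomorphism exchanging the initial sets, once `x` and `y` are exchanged. -/
theorem exists_isSwap_of_seq [T2Space X] {A B : ℕ → Set X} (hA : Antitone A) (hB : Antitone B)
    (hAc : ∀ n, IsClopen (A n)) (hBc : ∀ n, IsClopen (B n)) (hAB : Disjoint (A 0) (B 0))
    {σ : ℕ → X ≃ₜ X} (hσ : ∀ n, IsSwap (σ n) (A n \ A (n + 1)) (B n \ B (n + 1))) {x y : X}
    (hx : ∀ n, x ∈ A n) (hy : ∀ n, y ∈ B n) (hxA : ∀ U ∈ nhds x, ∃ n, A n ⊆ U)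
    (hyB : ∀ U ∈ nhds y, ∃ n, B n ⊆ U) :
    ∃ g : X ≃ₜ X, IsSwap g (A 0) (B 0) ∧ g x = y ∧ g y = x ∧
      ∀ z, z ≠ x → z ≠ y → g z = z ∨ ∃ n, g z = σ n z := by
  classical
  rw [Set.disjoint_left] at hAB
  have hA0 : ∀ n, A n ⊆ A 0 := fun n => hA (Nat.zero_le n)
  have hB0 : ∀ n, B n ⊆ B 0 := fun n => hB (Nat.zero_le n)
  have hxy : x ≠ y := fun h => hAB (hx 0) (h ▸ hy 0)
  -- Away from `x` and `y`, the points of `A 0 ∪ B 0` are partitioned into the levels `L n`,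
  -- on each of which the new map is `σ n`.
  let L : ℕ → Set X := fun n => (A n \ A (n + 1)) ∪ (B n \ B (n + 1))
  have hLc : ∀ n, IsOpen (L n) := fun n =>
    (((hAc n).diff (hAc _)).union ((hBc n).diff (hBc _))).isOpen
  have hLu : ∀ {z m n}, z ∈ L m → z ∈ L n → m = n := by
    rintro z m n (hm | hm) (hn | hn)
    · exact eq_of_mem_diff_succ hA hm hn
    · exact absurd (hB0 _ hn.1) (hAB (hA0 _ hm.1))
    · exact absurd (hB0 _ hm.1) (hAB (hA0 _ hn.1))
    · exact eq_of_mem_diff_succ hB hm hn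
  have hLx : ∀ {z n}, z ∈ L n → z ≠ x := by
    rintro z n (h | h) rfl
    · exact h.2 (hx _)
    · exact hAB (hx 0) (hB0 _ h.1)
  have hLy : ∀ {z n}, z ∈ L n → z ≠ y := by
    rintro z n (h | h) rfl
    · exact hAB (hA0 _ h.1) (hy 0)
    · exact h.2 (hy _)
  have hAL : ∀ {z n}, z ∈ A n → z ≠ x → ∃ m ≥ n, z ∈ A m \ A (m + 1) := by
    intro z n hz hzx
    obtain ⟨k, hk⟩ := hxA {z}ᶜ (isOpen_compl_singleton.mem_nhds hzx.symm)
    exact exists_mem_diff_succ hz (fun h => hk h rfl) hA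
  have hBL : ∀ {z n}, z ∈ B n → z ≠ y → ∃ m ≥ n, z ∈ B m \ B (m + 1) := by
    intro z n hz hzx
    obtain ⟨k, hk⟩ := hyB {z}ᶜ (isOpen_compl_singleton.mem_nhds hzx.symm)
    exact exists_mem_diff_succ hz (fun h => hk h rfl) hB
  let f : X → X := fun z => if z = x then y else if z = y then x else
    if h : ∃ n, z ∈ L n then σ h.choose z else z
  have hfx : f x = y := by simp [f]
  have hfy : f y = x := by simp [f, hxy.symm]
  have hfL : ∀ {z n}, z ∈ L n → f z = σ n z := by
    intro z n hz
    have h : ∃ n, z ∈ L n := ⟨n, hz⟩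
    simp only [f, hLx hz, hLy hz, if_false, dif_pos h]
    rw [hLu h.choose_spec hz]
  have hff : ∀ {z}, z ∉ A 0 → z ∉ B 0 → f z = z := by
    intro z h1 h2
    have h : ¬ ∃ n, z ∈ L n := by
      rintro ⟨n, h | h⟩
      · exact h1 (hA0 _ h.1)
      · exact h2 (hB0 _ h.1)
    have hzx : z ≠ x := fun h => h1 (h ▸ hx 0)
    have hzy : z ≠ y := fun h => h2 (h ▸ hy 0)
    simp only [f, hzx, hzy, if_false, dif_neg h]
  have hfAB : ∀ {z n}, z ∈ A n → f z ∈ B n := by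
    intro z n hz
    by_cases hzx : z = x
    · rw [hzx, hfx]; exact hy n
    · obtain ⟨m, hm, hzm⟩ := hAL hz hzx
      rw [hfL (Or.inl hzm)]
      exact hB hm ((hσ m).mapsTo z hzm).1
  have hfBA : ∀ {z n}, z ∈ B n → f z ∈ A n := by
    intro z n hz
    by_cases hzy : z = y
    · rw [hzy, hfy]; exact hx n
    · obtain ⟨m, hm, hzm⟩ := hBL hz hzy
      rw [hfL (Or.inr hzm)]
      exact hA hm ((hσ m).mapsTo' z hzm).1
  have hcases : ∀ z, z = x ∨ z = y ∨ (∃ n, z ∈ L n) ∨ (z ∉ A 0 ∧ z ∉ B 0) := by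
    intro z
    by_cases hzx : z = x
    · exact Or.inl hzx
    by_cases hzy : z = y
    · exact Or.inr (Or.inl hzy)
    refine Or.inr (Or.inr ?_)
    by_cases hzA : z ∈ A 0
    · obtain ⟨m, -, hm⟩ := hAL hzA hzx
      exact Or.inl ⟨m, Or.inl hm⟩
    by_cases hzB : z ∈ B 0
    · obtain ⟨m, -, hm⟩ := hBL hzB hzy
      exact Or.inl ⟨m, Or.inr hm⟩
    exact Or.inr ⟨hzA, hzB⟩
  have hinv : Function.Involutive f := by
    intro z
    rcases hcases z with rfl | rfl | ⟨n, hn⟩ | ⟨h1, h2⟩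
    · rw [hfx, hfy]
    · rw [hfy, hfx]
    · rw [hfL hn, hfL (n := n), (hσ n).involutive]
      exact hn.elim (fun h => Or.inr ((hσ n).mapsTo z h)) fun h => Or.inl ((hσ n).mapsTo' z h)
    · rw [hff h1 h2, hff h1 h2]
  have hcont : Continuous f := by
    rw [continuous_iff_continuousAt]
    intro z
    rcases hcases z with rfl | rfl | ⟨n, hn⟩ | ⟨h1, h2⟩
    · intro V hV
      rw [hfx] at hV
      obtain ⟨n, hn⟩ := hyB V hV
      rw [Filter.mem_map]
      exact Filter.mem_of_superset ((hAc n).isOpen.mem_nhds (hx n)) fun w hw => hn (hfAB (n := n) hw)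
    · intro V hV
      rw [hfy] at hV
      obtain ⟨n, hn⟩ := hxA V hV
      rw [Filter.mem_map]
      exact Filter.mem_of_superset ((hBc n).isOpen.mem_nhds (hy n)) fun w hw => hn (hfBA (n := n) hw)
    · refine (σ n).continuous.continuousAt.congr ?_
      filter_upwards [(hLc n).mem_nhds hn] with w hw
      exact (hfL hw).symm
    · refine continuousAt_id.congr ?_
      filter_upwards [(hAc 0).compl.isOpen.mem_nhds h1, (hBc 0).compl.isOpen.mem_nhds h2]
        with w hw1 hw2
      exact (hff hw1 hw2).symm
  refine ⟨Homeomorph.ofInvolutive f hinv hcont, ⟨hinv, fun z hz => hfAB hz, fun z hz => hfBA hz,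
    fun z h1 h2 => hff h1 h2⟩, hfx, hfy, fun z hzx hzy => ?_⟩
  rcases hcases z with h | h | ⟨n, hn⟩ | ⟨h1, h2⟩
  · exact absurd h hzx
  · exact absurd h hzy
  · exact Or.inr ⟨n, hfL hn⟩
  · exact Or.inl (hff h1 h2)

end Gluing

/-! ### Transitivity on clopen sets of equal measure -/

section Transitivity

variable {X : Type*} [TopologicalSpace X] [MeasurableSpace X] [BorelSpace X] [CompactSpace X]
  [TopologicalSpace.MetrizableSpace X] [TotallyDisconnectedSpace X] [PerfectSpace X]

theorem IsAmple.exists_mem_fullGroupOfRel_isSwap {Γ : Subgroup (X ≃ₜ X)} (hΓ : IsAmple Γ)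
    (hmin : ActsMinimally Γ) {A B : Set X} (hA : IsClopen A) (hB : IsClopen B)
    (hAB : Disjoint A B) (hμ : ∀ μ ∈ invariantMeasures Γ, μ A = μ B) (hAne : A.Nonempty)
    (hBne : B.Nonempty) : ∃ g ∈ fullGroupOfRel (orbitEquivRel Γ), IsSwap g A B := by
  let := TopologicalSpace.metrizableSpaceMetric X
  obtain ⟨x, hx⟩ := hAne
  obtain ⟨y, hy, γ, hγ, hγx⟩ := (hmin x).inter_open_nonempty B hB.isOpen hBne
  -- Even steps shrink the first set towards `x`, odd steps the second towards `y`.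
  let State := {p : Set X × Set X // IsClopen p.1 ∧ IsClopen p.2 ∧ Disjoint p.1 p.2 ∧
    x ∈ p.1 ∧ y ∈ p.2 ∧ ∀ μ ∈ invariantMeasures Γ, μ p.1 = μ p.2}
  have hstep : ∀ (n : ℕ) (p : State), ∃ q : State, q.1.1 ⊆ p.1.1 ∧ q.1.2 ⊆ p.1.2 ∧
      (∃ σ ∈ Γ, IsSwap σ (p.1.1 \ q.1.1) (p.1.2 \ q.1.2)) ∧
      (Even n → q.1.1 ⊆ Metric.ball x (1 / (n + 1))) ∧
      (¬ Even n → q.1.2 ⊆ Metric.ball y (1 / (n + 1))) := by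
    rintro n ⟨⟨C, D⟩, hC, hD, hCD, hxC, hyD, hμCD⟩
    have hpos : (0 : ℝ) < 1 / (n + 1) := by positivity
    by_cases hn : Even n
    · obtain ⟨σ, hσ, C', D', h1, h2, h3, h4, h5, h6, h7, h8, h9⟩ :=
        hΓ.exists_isSwap_shrink hmin hC hD hCD hμCD hxC hyD (Metric.ball_mem_nhds x hpos)
      exact ⟨⟨(C', D'), h4, h5, hCD.mono h1 h3, h6, h7, h8⟩, h1, h3, ⟨σ, hσ, h9⟩, fun _ => h2,
        fun h => absurd hn h⟩
    · obtain ⟨σ, hσ, D', C', h1, h2, h3, h4, h5, h6, h7, h8, h9⟩ :=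
        hΓ.exists_isSwap_shrink hmin hD hC hCD.symm (fun μ h => (hμCD μ h).symm) hyD hxC
          (Metric.ball_mem_nhds y hpos)
      exact ⟨⟨(C', D'), h5, h4, hCD.mono h3 h1, h7, h6, fun μ h => (h8 μ h).symm⟩, h3, h1,
        ⟨σ, hσ, h9.symm⟩, fun h => absurd h hn, fun _ => h2⟩
  choose next hnA hnB hnσ hnx hny using hstep
  let s : ℕ → State := fun n => Nat.rec ⟨(A, B), hA, hB, hAB, hx, hy, hμ⟩ next n
  choose σ hσΓ hσ using fun n => hnσ n (s n)
  have hmonoA : Antitone fun n => (s n).1.1 := antitone_nat_of_succ_le fun n => hnA n (s n)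
  have hmonoB : Antitone fun n => (s n).1.2 := antitone_nat_of_succ_le fun n => hnB n (s n)
  obtain ⟨g, hg, hgx, hgy, hgσ⟩ := exists_isSwap_of_seq hmonoA hmonoB (fun n => (s n).2.1)
    (fun n => (s n).2.2.1) hAB hσ (fun n => (s n).2.2.2.2.1) (fun n => (s n).2.2.2.2.2.1)
    (fun U hU => by
      obtain ⟨ε, hε, hεU⟩ := Metric.mem_nhds_iff.1 hU
      obtain ⟨k, hk⟩ := exists_nat_one_div_lt hε
      refine ⟨2 * k + 1, (hnx (2 * k) _ (by simp)).trans ((Metric.ball_subset_ball ?_).trans hεU)⟩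
      refine le_trans (one_div_le_one_div_of_le (by positivity) ?_) hk.le
      push_cast
      linarith [k.cast_nonneg (α := ℝ)])
    (fun U hU => by
      obtain ⟨ε, hε, hεU⟩ := Metric.mem_nhds_iff.1 hU
      obtain ⟨k, hk⟩ := exists_nat_one_div_lt hε
      refine ⟨2 * k + 1 + 1, (hny (2 * k + 1) _ (by simp)).trans
        ((Metric.ball_subset_ball ?_).trans hεU)⟩
      refine le_trans (one_div_le_one_div_of_le (by positivity) ?_) hk.le
      push_cast
      linarith [k.cast_nonneg (α := ℝ)])
  refine ⟨g, fun z => (orbitEquivRel Γ).symm ?_, hg⟩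
  by_cases hzx : z = x
  · exact ⟨γ, hγ, by rw [hzx, hgx, hγx]⟩
  by_cases hzy : z = y
  · exact ⟨γ⁻¹, Γ.inv_mem hγ, by rw [hzy, hgy, ← hγx]; exact γ.symm_apply_apply x⟩
  rcases hgσ z hzx hzy with h | ⟨n, h⟩
  · exact ⟨1, Γ.one_mem, h.symm⟩
  · exact ⟨σ n, hσΓ n, h.symm⟩

/-- Mapping `A` onto `B` is an open condition for the compact-open topology, so saturation
approximates an element of `[R_Γ]` by an element of `Γ` with the same effect. -/
theorem IsSaturated.exists_mem_of_mem_fullGroupOfRel {X : Type*} [TopologicalSpace X]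
    [CompactSpace X] {Γ : Subgroup (X ≃ₜ X)} (hsat : IsSaturated Γ) {g : X ≃ₜ X}
    (hg : g ∈ fullGroupOfRel (orbitEquivRel Γ)) {A B : Set X} (hA : IsClopen A) (hB : IsClopen B)
    (hgAB : ∀ x, g x ∈ B ↔ x ∈ A) : ∃ γ ∈ Γ, ∀ x, γ x ∈ B ↔ x ∈ A := by
  have hcl : g ∈ closure (Γ : Set (X ≃ₜ X)) := by
    rw [hsat]
    exact subset_closure hg
  let ι : (X ≃ₜ X) → C(X, X) := fun g => ⟨g, g.continuous⟩
  have hι : Continuous ι := continuous_induced_dom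
  have hopen : IsOpen (ι ⁻¹' ({f | MapsTo f A B} ∩ {f | MapsTo f Aᶜ Bᶜ})) :=
    ((ContinuousMap.isOpen_setOfPred_mapsTo hA.isClosed.isCompact hB.isOpen).inter
      (ContinuousMap.isOpen_setOfPred_mapsTo hA.compl.isClosed.isCompact hB.compl.isOpen)).preimage hι
  obtain ⟨γ, ⟨h1, h2⟩, hγ⟩ := mem_closure_iff.1 hcl _ hopen
    ⟨fun x hx => (hgAB x).2 hx, fun x hx h => hx ((hgAB x).1 h)⟩
  exact ⟨γ, hγ, fun x => ⟨fun hx => by_contra fun hxA => h2 hxA hx, fun hx => h1 hx⟩⟩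

theorem IsSaturated.exists_mem_of_measure_eq [Nonempty X] {Γ : Subgroup (X ≃ₜ X)}
    (hsat : IsSaturated Γ) (hΓ : IsAmple Γ) (hmin : ActsMinimally Γ) {A B : Set X}
    (hA : IsClopen A) (hB : IsClopen B) (hμ : ∀ μ ∈ invariantMeasures Γ, μ A = μ B) :
    ∃ γ ∈ Γ, ∀ x, γ x ∈ B ↔ x ∈ A := by
  have hdiff : ∀ μ ∈ invariantMeasures Γ, μ (A \ B) = μ (B \ A) := by
    intro μ hμΓ
    have := hμΓ.1
    have h1 := hμ μ hμΓ
    rw [← measure_inter_add_sdiff A hB.isOpen.measurableSet,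
      ← measure_inter_add_sdiff B hA.isOpen.measurableSet, inter_comm B A] at h1
    exact (ENNReal.add_right_inj (measure_ne_top _ _)).1 h1
  obtain ⟨μ, hμΓ⟩ := hΓ.invariantMeasures_nonempty
  have hpos : ∀ C, IsClopen C → C.Nonempty → μ C ≠ 0 := by
    intro C hC hne h0
    obtain ⟨c, hc, hcC⟩ := hmin.exists_le_measure hC.isOpen hne
    exact hc (le_antisymm (h0 ▸ hcC μ hμΓ) zero_le)
  rcases (A \ B).eq_empty_or_nonempty with h1 | h1
  · rcases (B \ A).eq_empty_or_nonempty with h2 | h2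
    · rw [sdiff_eq_empty] at h1 h2
      rw [h1.antisymm h2]
      exact ⟨1, Γ.one_mem, fun _ => Iff.rfl⟩
    · exact absurd (by rw [← hdiff μ hμΓ, h1, measure_empty]) (hpos _ (hB.diff hA) h2)
  · rcases (B \ A).eq_empty_or_nonempty with h2 | h2
    · exact absurd (by rw [hdiff μ hμΓ, h2, measure_empty]) (hpos _ (hA.diff hB) h1)
    · obtain ⟨g, hg, hsw⟩ := hΓ.exists_mem_fullGroupOfRel_isSwap hmin (hA.diff hB) (hB.diff hA)
        disjoint_sdiff_sdiff hdiff h1 h2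
      refine hsat.exists_mem_of_mem_fullGroupOfRel hg hA hB fun x => ?_
      have h3 := hsw.mapsTo x
      have h4 := hsw.mapsTo' x
      have h5 := hsw.fix x
      simp only [mem_sdiff] at h3 h4 h5
      by_cases hxA : x ∈ A <;> by_cases hxB : x ∈ B <;> grind

end Transitivity

/-! ### Modifying the action of a finite group -/

section Modification

theorem MulAction.exists_orbit_representative (G : Type*) [Group G] (ι : Type*) [MulAction G ι] :
    ∃ t : ι → ι, (∀ i, ∃ a : G, a • t i = i) ∧ ∀ (k : G) i, t (k • i) = t i := by
  refine ⟨fun i => (Quotient.mk (MulAction.orbitRel G ι) i).out, fun i => ?_, fun k i => ?_⟩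
  · exact MulAction.orbitRel_apply.1 ((MulAction.orbitRel G ι).symm
      (Quotient.mk_out (s := MulAction.orbitRel G ι) i))
  · simp only
    congr 1
    exact Quotient.sound (s := MulAction.orbitRel G ι) (MulAction.orbitRel_apply.2 ⟨k, rfl⟩)

variable {X : Type*} [TopologicalSpace X]

/-- Let `c` be a `K`-equivariant clopen partition on whose atoms setwise stabilizers act trivially, and
suppose `Λ` contains `H` and can realize the action of `K` on clopen sets. Then `K` is conjugated
into `Λ` by a homeomorphism that preserves every atom and commutes with `H`.

Fix an atom `t i` in each `K`-orbit of atoms. With `a i ∈ K` and `l i ∈ Λ` mapping `t i` onto `i`,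
the homeomorphism is `l i * (a i)⁻¹` on the atom `i`. It commutes with `H` because the `l i` are
chosen on representatives of the `H`-orbits of atoms and transported by `H`. -/
theorem exists_conj_mem_of_equivariant_coloring {H K Λ : Subgroup (X ≃ₜ X)} (hHK : H ≤ K)
    (hHΛ : H ≤ Λ) (hΛ : IsFullGroup Λ)
    (hKΛ : ∀ γ ∈ K, ∀ A B, IsClopen A → IsClopen B → (∀ x, γ x ∈ B ↔ x ∈ A) →
      ∃ l ∈ Λ, ∀ x, l x ∈ B ↔ x ∈ A)
    {ι : Type*} [Finite ι] [MulAction K ι] {c : X → ι} (hc : IsLocallyConstant c)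
    (hcK : ∀ (k : K) x, c ((k : X ≃ₜ X) x) = k • c x)
    (hfree : ∀ (k : K) x, k • c x = c x → (k : X ≃ₜ X) x = x) :
    ∃ g : X ≃ₜ X, (∀ x, c (g x) = c x) ∧ (∀ h ∈ H, g * h = h * g) ∧
      (∀ k ∈ K, g * k * g⁻¹ ∈ Λ) ∧ ∀ x, ∃ l ∈ Λ, ∃ k ∈ K, g x = l (k x) := by
  classical
  have hfree' : ∀ (p q : K) x, p • c x = q • c x → (p : X ≃ₜ X) x = (q : X ≃ₜ X) x := by
    intro p q x h
    have h1 := hfree (q⁻¹ * p) x (by rw [mul_smul, h, inv_smul_smul])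
    have h2 : (q : X ≃ₜ X).symm ((p : X ≃ₜ X) x) = x := h1
    rwa [Homeomorph.symm_apply_eq] at h2
  obtain ⟨t, ht, htK⟩ := MulAction.exists_orbit_representative K ι
  choose a ha using ht
  obtain ⟨r, hr, hrH⟩ := MulAction.exists_orbit_representative (H.subgroupOf K) ι
  choose b hb using hr
  have hlam : ∀ i, ∃ l ∈ Λ, ∀ x, c (l x) = i ↔ c x = t i := fun i =>
    hKΛ (a i) (a i).2 (c ⁻¹' {t i}) (c ⁻¹' {i}) (hc.isClopen_fiber _) (hc.isClopen_fiber _)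
      fun x => by
        change c _ = i ↔ c x = t i
        rw [hcK]
        conv_lhs => rhs; rw [← ha i]
        exact smul_left_cancel_iff _
  choose l₀ hl₀Λ hl₀ using hlam
  have htr : ∀ i, t (r i) = t i := fun i => by
    conv_rhs => rw [← hb i]
    exact (htK _ _).symm
  let l : ι → X ≃ₜ X := fun i => (b i : K) * l₀ (r i)
  have hlΛ : ∀ i, l i ∈ Λ := fun i => Λ.mul_mem (hHΛ (b i).2) (hl₀Λ _)
  have hl : ∀ i x, c (l i x) = i ↔ c x = t i := by
    intro i x
    rw [← htr, ← hl₀ (r i) x]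
    change c (((b i : K) : X ≃ₜ X) (l₀ (r i) x)) = i ↔ _
    rw [hcK]
    conv_lhs => rhs; rw [← hb i]
    exact smul_left_cancel_iff _
  have hlH : ∀ (k : H.subgroupOf K) i x, c x = t i →
      l (k • i) x = ((k : K) : X ≃ₜ X) (l i x) := by
    intro k i x hx
    have h1 : c (l₀ (r i) x) = r i := (hl₀ _ _).2 (by rw [hx, htr])
    change ((b (k • i) : K) : X ≃ₜ X) (l₀ (r (k • i)) x) =
      (((k : K) * (b i : K) : K) : X ≃ₜ X) (l₀ (r i) x)
    rw [hrH]
    refine hfree' _ _ _ ?_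
    rw [h1, mul_smul]
    have h2 := hb (k • i)
    rw [hrH] at h2
    exact h2.trans (congrArg (k • ·) (hb i).symm)
  let f : X → X := fun x => l (c x) ((a (c x) : X ≃ₜ X).symm x)
  let f' : X → X := fun y => (a (c y) : X ≃ₜ X) ((l (c y)).symm y)
  have hca : ∀ x, c ((a (c x) : X ≃ₜ X).symm x) = t (c x) := by
    intro x
    have h : c ((((a (c x))⁻¹ : K) : X ≃ₜ X) x) = (a (c x))⁻¹ • c x := hcK _ _
    refine h.trans ?_
    rw [inv_smul_eq_iff, ha]
  have hcl : ∀ y, c ((l (c y)).symm y) = t (c y) := by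
    intro y
    rw [← hl, Homeomorph.apply_symm_apply]
  have hcf : ∀ x, c (f x) = c x := fun x => (hl _ _).2 (hca x)
  have hcf' : ∀ y, c (f' y) = c y := fun y => by
    change c ((a (c y) : X ≃ₜ X) _) = _
    rw [hcK, hcl, ha]
  let g : X ≃ₜ X :=
    { toFun := f
      invFun := f'
      left_inv := fun x => by
        change (a (c (f x)) : X ≃ₜ X) ((l (c (f x))).symm (f x)) = x
        rw [hcf]
        change (a (c x) : X ≃ₜ X) ((l (c x)).symm (l (c x) ((a (c x) : X ≃ₜ X).symm x))) = x
        rw [Homeomorph.symm_apply_apply, Homeomorph.apply_symm_apply]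
      right_inv := fun y => by
        change l (c (f' y)) ((a (c (f' y)) : X ≃ₜ X).symm (f' y)) = y
        rw [hcf']
        change l (c y) ((a (c y) : X ≃ₜ X).symm ((a (c y) : X ≃ₜ X) ((l (c y)).symm y))) = y
        rw [Homeomorph.symm_apply_apply, Homeomorph.apply_symm_apply]
      continuous_toFun := by
        rw [continuous_iff_continuousAt]
        intro x
        refine ((l (c x)).continuous.comp (a (c x) : X ≃ₜ X).symm.continuous).continuousAt.congr ?_
        filter_upwards [hc.eventually_eq x] with z hz
        simp only [f, hz, Function.comp_apply]
      continuous_invFun := by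
        rw [continuous_iff_continuousAt]
        intro x
        refine ((a (c x) : X ≃ₜ X).continuous.comp (l (c x)).symm.continuous).continuousAt.congr ?_
        filter_upwards [hc.eventually_eq x] with z hz
        simp only [f', hz, Function.comp_apply] }
  -- The element of `K` mapping the atom `k • c x` back to its representative is determined on that
  -- atom, so it can be replaced by the one for `c x`.
  have hfK : ∀ (k : K) x, f ((k : X ≃ₜ X) x) = l (k • c x) ((a (c x) : X ≃ₜ X).symm x) := by
    intro k x
    simp only [f]
    rw [hcK]
    congr 1
    refine hfree' ((a (k • c x))⁻¹ * k) (a (c x))⁻¹ x ?_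
    rw [mul_smul, inv_smul_eq_iff]
    nth_rw 1 [← ha (k • c x)]
    rw [htK]
    congr 1
    rw [eq_inv_smul_iff, ha]
  refine ⟨g, hcf, fun h hh => ?_, fun k hk => ?_, fun x => ?_⟩
  · ext x
    change f (h x) = h (f x)
    refine (hfK ⟨h, hHK hh⟩ x).trans ?_
    exact hlH ⟨⟨h, hHK hh⟩, hh⟩ (c x) _ (hca x)
  · have := Fintype.ofFinite ι
    have hmem : g * k * g⁻¹ ∈ topologicalFullGroup Λ := by
      refine ⟨Finset.univ.image fun p : ι × ι => l p.1 * (l p.2)⁻¹, ?_, fun y => ?_⟩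
      · intro s hs
        simp only [Finset.coe_image, Finset.coe_univ, image_univ, mem_range] at hs
        obtain ⟨p, rfl⟩ := hs
        exact Λ.mul_mem (hlΛ _) (Λ.inv_mem (hlΛ _))
      · refine ⟨l ((⟨k, hk⟩ : K) • c y) * (l (c y))⁻¹,
          Finset.mem_image.2 ⟨(_, _), Finset.mem_univ _, rfl⟩, ?_⟩
        change f (k (f' y)) = l _ ((l (c y)).symm y)
        refine (hfK ⟨k, hk⟩ _).trans ?_
        rw [hcf']
        congr 1
        exact Homeomorph.symm_apply_apply _ _
    rw [← hΛ] at hmem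
    exact hmem
  · exact ⟨l (c x), hlΛ _, (a (c x) : X ≃ₜ X)⁻¹, K.inv_mem (a (c x)).2, rfl⟩

end Modification

/-! ### Fine clopen partitions -/

section Coloring

universe u

variable {X : Type u} [MetricSpace X] [CompactSpace X]

/-- By compactness, a homeomorphism with clopen fixed-point set moves the points it does not fix by at
least a fixed amount. -/
theorem eventually_forall_lt_dist {h : X ≃ₜ X} (hfix : IsClopen {x | h x = x}) :
    ∀ᶠ δ in nhdsWithin (0 : ℝ) (Ioi 0), ∀ x, h x ≠ x → δ < dist (h x) x := by
  rcases {x | h x = x}ᶜ.eq_empty_or_nonempty with he | hne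
  · refine Filter.Eventually.of_forall fun δ x hx => ?_
    have : x ∈ {x | h x = x}ᶜ := hx
    rw [he] at this
    exact this.elim
  · obtain ⟨z, hz, hmin⟩ := hfix.compl.isClosed.isCompact.exists_isMinOn hne
      ((h.continuous.dist continuous_id).continuousOn (s := {x | h x = x}ᶜ))
    filter_upwards [Ioo_mem_nhdsGT (dist_pos.2 hz)] with δ hδ x hx
    exact hδ.2.trans_le (hmin hx)

variable [TotallyDisconnectedSpace X]

/-- A finite clopen partition into sets of small diameter. -/
theorem exists_isLocallyConstant_dist_lt {ε : ℝ} (hε : 0 < ε) :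
    ∃ (F : Type u) (_ : Finite F) (f : X → F), IsLocallyConstant f ∧
      ∀ x y, f x = f y → dist x y < ε := by
  have h : ∀ x : X, ∃ C, IsClopen C ∧ x ∈ C ∧ C ⊆ Metric.ball x (ε / 2) := fun x =>
    compact_exists_isClopen_in_isOpen Metric.isOpen_ball (Metric.mem_ball_self (half_pos hε))
  choose C hC hxC hCb using h
  obtain ⟨t, ht⟩ := isCompact_univ.elim_finite_subcover C (fun x => (hC x).isOpen)
    fun x _ => mem_iUnion.2 ⟨x, hxC x⟩
  refine ⟨t → Prop, inferInstance, fun x z => x ∈ C z, ?_, fun x y hxy => ?_⟩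
  · rw [IsLocallyConstant.iff_eventually_eq]
    intro x
    have h : ∀ᶠ y in nhds x, ∀ z : t, (y ∈ C z) = (x ∈ C z) := by
      rw [Filter.eventually_all]
      intro z
      by_cases hx : x ∈ C z
      · filter_upwards [(hC z).isOpen.mem_nhds hx] with y hy
        simp [hx, hy]
      · filter_upwards [(hC z).compl.isOpen.mem_nhds hx] with y hy
        simp only [hx, eq_iff_iff, iff_false]
        exact hy
    filter_upwards [h] with y hy
    exact funext hy
  · obtain ⟨z, hz, hxz⟩ := mem_iUnion₂.1 (ht (mem_univ x))
    have hyz : y ∈ C z := by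
      have := congrFun hxy ⟨z, hz⟩
      simp only [eq_iff_iff] at this
      exact this.1 hxz
    have h1 := hCb z hxz
    have h2 := hCb z hyz
    rw [Metric.mem_ball] at h1 h2
    linarith [dist_triangle_right x y z]

/-- The equivariant partition records the positions of all `k x`, `k ∈ K`, in a partition finer than
the displacements of the elements of `K`. -/
theorem exists_conj_mem_of_finite {H K Λ : Subgroup (X ≃ₜ X)} [Finite K] (hHK : H ≤ K)
    (hfix : ∀ k ∈ K, IsClopen {x | k x = x})
    (hHΛ : H ≤ Λ) (hΛ : IsFullGroup Λ)
    (hKΛ : ∀ γ ∈ K, ∀ A B, IsClopen A → IsClopen B → (∀ x, γ x ∈ B ↔ x ∈ A) →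
      ∃ l ∈ Λ, ∀ x, l x ∈ B ↔ x ∈ A) {ε : ℝ} (hε : 0 < ε) :
    ∃ g : X ≃ₜ X, (∀ x, dist (g x) x < ε) ∧ (∀ h ∈ H, g * h = h * g) ∧
      (∀ k ∈ K, g * k * g⁻¹ ∈ Λ) ∧ ∀ x, ∃ l ∈ Λ, ∃ k ∈ K, g x = l (k x) := by
  have hev : ∀ᶠ δ in nhdsWithin (0 : ℝ) (Ioi 0), ∀ k : K, ∀ x, (k : X ≃ₜ X) x ≠ x →
      δ < dist ((k : X ≃ₜ X) x) x :=
    Filter.eventually_all.2 fun k => eventually_forall_lt_dist (hfix k k.2)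
  obtain ⟨δ, hδK, hδ, hδε⟩ := (hev.and (Ioo_mem_nhdsGT hε)).exists
  obtain ⟨F, hF, f, hf, hfδ⟩ := exists_isLocallyConstant_dist_lt (X := X) hδ
  -- Right translation of functions on `K` makes `x ↦ (k ↦ f (k x))` equivariant.
  let act : MulAction K (K → F) :=
    { smul := fun k φ h => φ (h * k)
      one_smul := fun φ => funext fun h => congrArg φ (mul_one h)
      mul_smul := fun k l φ => funext fun h => congrArg φ (mul_assoc h k l).symm }
  let c : X → K → F := fun x h => f ((h : X ≃ₜ X) x)
  have hc : IsLocallyConstant c := by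
    rw [IsLocallyConstant.iff_eventually_eq]
    intro x
    have h : ∀ᶠ y in nhds x, ∀ k : K, c y k = c x k :=
      Filter.eventually_all.2 fun k => (hf.comp_continuous k.1.continuous).eventually_eq x
    filter_upwards [h] with y hy
    exact funext hy
  obtain ⟨g, hg, h1, h2, h3⟩ := exists_conj_mem_of_equivariant_coloring hHK hHΛ hΛ hKΛ hc
    (fun k x => rfl) (fun k x hkx => by
      by_contra hne
      have h := hfδ ((k : X ≃ₜ X) x) x (congrFun hkx 1)
      exact absurd h (hδK k x hne).le.not_gt)
  exact ⟨g, fun x => (hfδ _ _ (congrFun (hg x) 1)).trans hδε, h1, h2, h3⟩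

end Coloring

/-! ### Uniform limits of homeomorphisms -/

section Limit

variable {X : Type*} [MetricSpace X] [CompactSpace X]

/-- The group of homeomorphisms is complete for convergence of both `g` and `g⁻¹`. -/
theorem Homeomorph.exists_tendsto_of_dist_le {g : ℕ → X ≃ₜ X}
    (h : ∀ n x, dist (g n x) (g (n + 1) x) ≤ (1 / 2) ^ n)
    (h' : ∀ n x, dist ((g n).symm x) ((g (n + 1)).symm x) ≤ (1 / 2) ^ n) :
    ∃ f : X ≃ₜ X, ∀ x, Filter.Tendsto (fun n => g n x) Filter.atTop (nhds (f x)) := by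
  let G : ℕ → C(X, X) := fun n => ⟨g n, (g n).continuous⟩
  let G' : ℕ → C(X, X) := fun n => ⟨(g n).symm, (g n).symm.continuous⟩
  have hG : CauchySeq G := cauchySeq_of_le_geometric (1 / 2) 1 (by norm_num) fun n => by
    rw [one_mul, ContinuousMap.dist_le (by positivity)]
    exact h n
  have hG' : CauchySeq G' := cauchySeq_of_le_geometric (1 / 2) 1 (by norm_num) fun n => by
    rw [one_mul, ContinuousMap.dist_le (by positivity)]
    exact h' n
  have hpt : ∀ {Φ : ℕ → C(X, X)} {F : C(X, X)}, Filter.Tendsto Φ Filter.atTop (nhds F) →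
      ∀ x, Filter.Tendsto (fun n => Φ n x) Filter.atTop (nhds (F x)) := fun hF x =>
    ((continuous_eval_const x).tendsto _).comp hF
  have : Nonempty C(X, X) := ⟨ContinuousMap.id X⟩
  obtain ⟨F, hF⟩ := cauchySeq_tendsto_of_complete hG
  obtain ⟨F', hF'⟩ := cauchySeq_tendsto_of_complete hG'
  have hcomp : F.comp F' = ContinuousMap.id X := by
    refine tendsto_nhds_unique (hF.compCM hF') ?_
    refine tendsto_const_nhds.congr fun n => ?_
    ext x
    exact ((g n).apply_symm_apply x).symm
  have hcomp' : F'.comp F = ContinuousMap.id X := by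
    refine tendsto_nhds_unique (hF'.compCM hF) ?_
    refine tendsto_const_nhds.congr fun n => ?_
    ext x
    exact ((g n).symm_apply_apply x).symm
  exact ⟨{  toFun := F
            invFun := F'
            left_inv := fun x => DFunLike.congr_fun hcomp' x
            right_inv := fun x => DFunLike.congr_fun hcomp x
            continuous_toFun := F.continuous
            continuous_invFun := F'.continuous }, hpt hF⟩

end Limit

/-! ### Conjugates of full groups -/

section FullGroup

variable {X : Type*} [TopologicalSpace X]

theorem IsFullGroup.comap_conj {Λ : Subgroup (X ≃ₜ X)} (hΛ : IsFullGroup Λ) (g : X ≃ₜ X) :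
    IsFullGroup (Λ.comap (MulAut.conj g).toMonoidHom) := by
  classical
  refine Subset.antisymm (fun γ hγ => ⟨{γ}, by simpa using hγ, fun x => ⟨γ, by simp, rfl⟩⟩) ?_
  rintro f ⟨A, hA, hf⟩
  have hmem : g * f * g⁻¹ ∈ topologicalFullGroup Λ := by
    refine ⟨A.image fun s => g * s * g⁻¹, ?_, fun x => ?_⟩
    · intro s hs
      simp only [Finset.coe_image, mem_image] at hs
      obtain ⟨a, ha, rfl⟩ := hs
      exact hA ha
    · obtain ⟨s, hs, hsx⟩ := hf (g⁻¹ x)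
      exact ⟨g * s * g⁻¹, Finset.mem_image_of_mem _ hs, congrArg g hsx⟩
  rw [← hΛ] at hmem
  exact hmem

end FullGroup

/-! ### The back-and-forth construction -/

section BackAndForth

/-! ### Partial conjugacies -/

section PartialConjugacy

variable {X : Type*} [TopologicalSpace X] [MeasurableSpace X]

/-- A state of the back-and-forth construction: `g` identifies `M(Γ)` with `M(Λ)` and conjugates the
finite subgroup `H` of `Γ` into `Λ`. -/
structure IsPartialConj (Γ Λ : Subgroup (X ≃ₜ X)) (g : X ≃ₜ X) (H : Subgroup (X ≃ₜ X)) :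
    Prop where
  finite : Finite H
  le : H ≤ Γ
  conj_mem : ∀ h ∈ H, g * h * g⁻¹ ∈ Λ
  map_mem : ∀ μ ∈ invariantMeasures Γ, μ.map g ∈ invariantMeasures Λ
  map_symm_mem : ∀ ν ∈ invariantMeasures Λ, ν.map g.symm ∈ invariantMeasures Γ

theorem IsPartialConj.symm {Γ Λ : Subgroup (X ≃ₜ X)} {g : X ≃ₜ X} {H : Subgroup (X ≃ₜ X)}
    (h : IsPartialConj Γ Λ g H) :
    IsPartialConj Λ Γ g⁻¹ (H.map (MulAut.conj g).toMonoidHom) where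
  finite := by
    have := h.finite
    exact inferInstanceAs (Finite ((MulAut.conj g).toMonoidHom '' (H : Set (X ≃ₜ X))))
  le := by
    rintro _ ⟨a, ha, rfl⟩
    exact h.conj_mem a ha
  conj_mem := by
    rintro _ ⟨a, ha, rfl⟩
    have : g⁻¹ * (g * a * g⁻¹) * g⁻¹⁻¹ = a := by group
    exact (congrArg (· ∈ Γ) this).mpr (h.le ha)
  map_mem := h.map_symm_mem
  map_symm_mem := h.map_mem

/-- Clopen sets with the same measure for all `Γ`-invariant probability measures are equivalent under
`Γ`. -/
def IsTransitiveOnClopens (Γ : Subgroup (X ≃ₜ X)) : Prop :=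
  ∀ A B, IsClopen A → IsClopen B → (∀ μ ∈ invariantMeasures Γ, μ A = μ B) →
    ∃ γ ∈ Γ, ∀ x, γ x ∈ B ↔ x ∈ A

end PartialConjugacy

variable {X : Type*} [MetricSpace X] [CompactSpace X] [TotallyDisconnectedSpace X]
  [MeasurableSpace X] [BorelSpace X]

theorem IsPartialConj.exists_extension {Γ Λ : Subgroup (X ≃ₜ X)} {g : X ≃ₜ X}
    {H : Subgroup (X ≃ₜ X)} (hg : IsPartialConj Γ Λ g H) (hΓ : IsAmple Γ) (hΛ : IsAmple Λ)
    (hΛt : IsTransitiveOnClopens Λ) {K : Subgroup (X ≃ₜ X)} (hHK : H ≤ K) (hKΓ : K ≤ Γ)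
    [Finite K] {ε : ℝ} (hε : 0 < ε) :
    ∃ g' : X ≃ₜ X, IsPartialConj Γ Λ g' K ∧ (∀ h ∈ H, g' * h * g'⁻¹ = g * h * g⁻¹) ∧
      (∀ x, dist (g x) (g' x) < ε) ∧ ∀ x, dist (g.symm x) (g'.symm x) < ε := by
  -- The correction `s` is found for `Γ` and `g⁻¹ Λ g`, which have the same invariant measures and
  -- both contain `H`.
  set Λ' := Λ.comap (MulAut.conj g).toMonoidHom with hΛ'
  have hmem : ∀ l, l ∈ Λ' ↔ g * l * g⁻¹ ∈ Λ := fun l => Iff.rfl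
  have hcanc : ∀ μ : Measure X, (μ.map g).map g.symm = μ := fun μ => by
    rw [Measure.map_map g.symm.measurable g.measurable, Homeomorph.symm_comp_self, Measure.map_id]
  have hKΛ : ∀ γ ∈ K, ∀ A B, IsClopen A → IsClopen B → (∀ x, γ x ∈ B ↔ x ∈ A) →
      ∃ l ∈ Λ', ∀ x, l x ∈ B ↔ x ∈ A := by
    intro γ hγ A B hA hB hγAB
    obtain ⟨l, hl, hlAB⟩ := hΛt (g.symm ⁻¹' A) (g.symm ⁻¹' B) (hA.preimage g.symm.continuous)
      (hB.preimage g.symm.continuous) (by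
        intro ν hν
        rw [← Measure.map_apply g.symm.measurable hA.isOpen.measurableSet,
          ← Measure.map_apply g.symm.measurable hB.isOpen.measurableSet,
          ← measure_preimage_of_mem_invariantMeasures (hg.map_symm_mem ν hν) (hKΓ hγ)
            hB.isOpen.measurableSet]
        congr 1
        ext x
        exact (hγAB x).symm)
    refine ⟨g⁻¹ * l * g, ?_, fun x => (hlAB (g x)).trans ?_⟩
    · rw [hmem]
      convert hl using 1
      group
    · rw [mem_preimage, Homeomorph.symm_apply_apply]
  obtain ⟨δ, hδ, hδg⟩ := Metric.uniformContinuous_iff.1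
    (CompactSpace.uniformContinuous_of_continuous g.continuous) ε hε
  obtain ⟨s, hsδ, hsH, hsK, hsloc⟩ := exists_conj_mem_of_finite hHK
    (fun k hk => hΓ.isClopen_fixed k (hKΓ hk)) (fun h hh => (hmem h).2 (hg.conj_mem h hh))
    (hΛ.full.comap_conj g) hKΛ (lt_min hδ hε)
  have hΛ'c : (Λ' : Set (X ≃ₜ X)).Countable :=
    (countable_coe_iff.1 hΛ.countable).preimage (MulAut.conj g).injective
  have hs : ∀ μ ∈ invariantMeasures Γ, μ.map s = μ := by
    intro μ hμ
    refine map_eq_of_forall_exists_apply_eq (S := image2 (· * ·) (Λ' : Set (X ≃ₜ X)) K)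
      (hΛ'c.image2 (Set.toFinite (K : Set (X ≃ₜ X))).countable _) ?_ s fun x => ?_
    · rintro _ ⟨l, hl, k, hk, rfl⟩
      have h1 : μ.map l = μ := by
        have h2 := (hg.map_mem μ hμ).2 _ hl
        conv_rhs => rw [← hcanc μ, ← h2]
        rw [Measure.map_map (Homeomorph.measurable _) g.measurable,
          Measure.map_map g.symm.measurable
            ((Homeomorph.measurable _).comp g.measurable)]
        congr 1
        ext x
        change l x = g.symm (g (l (g.symm (g x))))
        rw [Homeomorph.symm_apply_apply, Homeomorph.symm_apply_apply]
      change μ.map (l ∘ k) = μ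
      rw [← Measure.map_map l.measurable k.measurable, hμ.2 k (hKΓ hk), h1]
    · obtain ⟨l, hl, k, hk, h⟩ := hsloc x
      exact ⟨l * k, ⟨l, hl, k, hk, rfl⟩, h⟩
  refine ⟨g * s, ⟨‹_›, hKΓ, fun k hk => ?_, fun μ hμ => ?_, fun ν hν => ?_⟩, fun h hh => ?_,
    fun x => ?_, fun x => ?_⟩
  · have h1 := (hmem _).1 (hsK k hk)
    convert h1 using 1
    group
  · change μ.map (g ∘ s) ∈ _
    rw [← Measure.map_map g.measurable s.measurable, hs μ hμ]
    exact hg.map_mem μ hμ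
  · change ν.map (s.symm ∘ g.symm) ∈ _
    have h1 := hg.map_symm_mem ν hν
    rw [← Measure.map_map s.symm.measurable g.symm.measurable, ← hs _ h1,
      Measure.map_map s.symm.measurable s.measurable, Homeomorph.symm_comp_self, Measure.map_id]
    exact h1
  · have h1 : s * h * s⁻¹ = h := by rw [hsH h hh, mul_inv_cancel_right]
    calc g * s * h * (g * s)⁻¹ = g * (s * h * s⁻¹) * g⁻¹ := by group
      _ = g * h * g⁻¹ := by rw [h1]
  · refine hδg ?_
    rw [dist_comm]
    exact (hsδ x).trans_le (min_le_left _ _)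
  · have h1 := hsδ (s.symm (g.symm x))
    rw [Homeomorph.apply_symm_apply] at h1
    exact h1.trans_le (min_le_right _ _)

theorem IsLocallyFiniteSubgroup.exists_finite_le {G : Type*} [Group G] {Γ H : Subgroup G}
    (hΓ : IsLocallyFiniteSubgroup Γ) (hH : H ≤ Γ) [Finite H] {γ : G} (hγ : γ ∈ Γ) :
    ∃ K ≤ Γ, Finite K ∧ H ≤ K ∧ γ ∈ K := by
  have hf : (insert γ (H : Set G)).Finite := (Set.toFinite (H : Set G)).insert γ
  have hsub : insert γ (H : Set G) ⊆ Γ := insert_subset hγ hH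
  have hfin := hΓ hf.toFinset (by simpa using hsub)
  rw [hf.coe_toFinset] at hfin
  exact ⟨Subgroup.closure (insert γ (H : Set G)), (Subgroup.closure_le _).2 hsub, hfin,
    fun h hh => Subgroup.subset_closure (Or.inr hh), Subgroup.subset_closure (Or.inl rfl)⟩

/-- A forth step adding `γ` to the domain, followed by a back step adding `l` to the range. -/
theorem IsPartialConj.exists_extension_mem {Γ Λ : Subgroup (X ≃ₜ X)} {g : X ≃ₜ X}
    {H : Subgroup (X ≃ₜ X)} (hg : IsPartialConj Γ Λ g H) (hΓ : IsAmple Γ) (hΛ : IsAmple Λ)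
    (hΓt : IsTransitiveOnClopens Γ) (hΛt : IsTransitiveOnClopens Λ) {γ l : X ≃ₜ X} (hγ : γ ∈ Γ)
    (hl : l ∈ Λ) {ε : ℝ} (hε : 0 < ε) :
    ∃ (g' : X ≃ₜ X) (H' : Subgroup (X ≃ₜ X)), IsPartialConj Γ Λ g' H' ∧ H ≤ H' ∧ γ ∈ H' ∧
      (∃ h ∈ H', g' * h * g'⁻¹ = l) ∧ (∀ h ∈ H, g' * h * g'⁻¹ = g * h * g⁻¹) ∧
      (∀ x, dist (g x) (g' x) < ε) ∧ ∀ x, dist (g.symm x) (g'.symm x) < ε := by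
  have := hg.finite
  obtain ⟨K, hKΓ, hK, hHK, hγK⟩ := hΓ.locallyFinite.exists_finite_le hg.le hγ
  obtain ⟨g₁, hg₁, hc₁, hd₁, hd₁'⟩ := hg.exists_extension hΓ hΛ hΛt hHK hKΓ (half_pos hε)
  have hs := hg₁.symm
  have := hs.finite
  obtain ⟨L, hLΛ, hL, hKL, hlL⟩ := hΛ.locallyFinite.exists_finite_le hs.le hl
  obtain ⟨g₂, hg₂, hc₂, hd₂, hd₂'⟩ := hs.exists_extension hΛ hΓ hΓt hKL hLΛ (half_pos hε)
  have hinv : ∀ k ∈ K, g₂ * (g₁ * k * g₁⁻¹) * g₂⁻¹ = k := by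
    intro k hk
    have h1 : g₂ * (g₁ * k * g₁⁻¹) * g₂⁻¹ = g₁⁻¹ * (g₁ * k * g₁⁻¹) * g₁⁻¹⁻¹ := hc₂ _ ⟨k, hk, rfl⟩
    rw [h1]
    group
  have hKL' : K ≤ L.map (MulAut.conj g₂).toMonoidHom := fun k hk =>
    ⟨g₁ * k * g₁⁻¹, hKL ⟨k, hk, rfl⟩, hinv k hk⟩
  refine ⟨g₂⁻¹, _, hg₂.symm, hHK.trans hKL', hKL' hγK,
    ⟨g₂ * l * g₂⁻¹, ⟨l, hlL, rfl⟩, by group⟩, fun h hh => ?_, fun x => ?_, fun x => ?_⟩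
  · rw [← hc₁ h hh]
    conv_lhs => rw [← hinv h (hHK hh)]
    group
  · have h1 := hd₁ x
    have h2 := hd₂' x
    exact (dist_triangle _ (g₁ x) _).trans_lt ((add_lt_add h1 h2).trans_eq (add_halves ε))
  · have h1 := hd₁' x
    have h2 := hd₂ x
    exact (dist_triangle _ (g₁.symm x) _).trans_lt ((add_lt_add h1 h2).trans_eq (add_halves ε))

theorem areConjugate_of_isPartialConj {Γ Λ : Subgroup (X ≃ₜ X)} {g : X ≃ₜ X}
    (hg : IsPartialConj Γ Λ g ⊥) (hΓ : IsAmple Γ) (hΛ : IsAmple Λ)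
    (hΓt : IsTransitiveOnClopens Γ) (hΛt : IsTransitiveOnClopens Λ) : AreConjugate Γ Λ := by
  have := hΓ.countable
  have := hΛ.countable
  obtain ⟨eΓ, heΓ⟩ := exists_surjective_nat Γ
  obtain ⟨eΛ, heΛ⟩ := exists_surjective_nat Λ
  let State := {p : (X ≃ₜ X) × Subgroup (X ≃ₜ X) // IsPartialConj Γ Λ p.1 p.2}
  have hstep : ∀ (n : ℕ) (p : State), ∃ q : State, p.1.2 ≤ q.1.2 ∧ (eΓ n : X ≃ₜ X) ∈ q.1.2 ∧
      (∃ h ∈ q.1.2, q.1.1 * h * q.1.1⁻¹ = eΛ n) ∧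
      (∀ h ∈ p.1.2, q.1.1 * h * q.1.1⁻¹ = p.1.1 * h * p.1.1⁻¹) ∧
      (∀ x, dist (p.1.1 x) (q.1.1 x) < (1 / 2) ^ n) ∧
      ∀ x, dist (p.1.1.symm x) (q.1.1.symm x) < (1 / 2) ^ n := by
    rintro n ⟨⟨g, H⟩, hgH⟩
    obtain ⟨g', H', h, h'⟩ := hgH.exists_extension_mem hΓ hΛ hΓt hΛt (eΓ n).2 (eΛ n).2
      (ε := (1 / 2) ^ n) (by positivity)
    exact ⟨⟨(g', H'), h⟩, h'⟩
  choose next hle hΓmem hΛmem hconj hd hd' using hstep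
  let s : ℕ → State := fun n => Nat.rec ⟨(g, ⊥), hg⟩ next n
  have hmono : Monotone fun n => (s n).1.2 := monotone_nat_of_le_succ fun n => hle n (s n)
  -- Once `h` has entered the domain, its conjugate is never changed, hence it is the conjugate by
  -- the limit.
  have hconst : ∀ n, ∀ h ∈ (s n).1.2, ∀ m ≥ n,
      (s m).1.1 * h * (s m).1.1⁻¹ = (s n).1.1 * h * (s n).1.1⁻¹ := by
    intro n h hh m hm
    induction m, hm using Nat.le_induction with
    | base => rfl
    | succ m hm ih => exact (hconj m (s m) h (hmono hm hh)).trans ih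
  obtain ⟨f, hf⟩ := Homeomorph.exists_tendsto_of_dist_le (g := fun n => (s n).1.1)
    (fun n x => (hd n (s n) x).le) (fun n x => (hd' n (s n) x).le)
  have hfconj : ∀ n, ∀ h ∈ (s n).1.2, f * h * f⁻¹ = (s n).1.1 * h * (s n).1.1⁻¹ := by
    intro n h hh
    rw [mul_inv_eq_iff_eq_mul]
    ext x
    have hlim : Filter.Tendsto
        (fun m => ((s n).1.1 * h * (s n).1.1⁻¹ : X ≃ₜ X) ((s m).1.1 x)) Filter.atTop
        (nhds (((s n).1.1 * h * (s n).1.1⁻¹ : X ≃ₜ X) (f x))) :=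
      ((Homeomorph.continuous _).tendsto _).comp (hf x)
    refine tendsto_nhds_unique (hf (h x)) (hlim.congr' ?_)
    filter_upwards [Filter.eventually_ge_atTop n] with m hm
    rw [← hconst n h hh m hm]
    change (s m).1.1 (h ((s m).1.1.symm ((s m).1.1 x))) = (s m).1.1 (h x)
    rw [Homeomorph.symm_apply_apply]
  refine ⟨f, le_antisymm ?_ fun l hl => ?_⟩
  · rintro _ ⟨γ, hγ, rfl⟩
    obtain ⟨n, hn⟩ := heΓ ⟨γ, hγ⟩
    have h1 := hΓmem n (s n)
    rw [hn] at h1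
    have h2 := hfconj (n + 1) γ h1
    exact (congrArg (· ∈ Λ) h2).mpr ((s (n + 1)).2.conj_mem γ h1)
  · obtain ⟨n, hn⟩ := heΛ ⟨l, hl⟩
    obtain ⟨h, hh, hhl⟩ := hΛmem n (s n)
    rw [hn] at hhl
    exact ⟨h, (s (n + 1)).2.le hh, (hfconj (n + 1) h hh).trans hhl⟩

end BackAndForth

/-! ### Orbit equivalence and invariant measures -/

section Invariance

variable {X : Type*} [TopologicalSpace X] [MeasurableSpace X] [BorelSpace X]

theorem AreConjugate.orbitEquivalent {X : Type*} [TopologicalSpace X] {Γ Λ : Subgroup (X ≃ₜ X)}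
    (h : AreConjugate Γ Λ) : OrbitEquivalent Γ Λ := by
  obtain ⟨g, rfl⟩ := h
  refine ⟨g, fun x x' => ⟨?_, ?_⟩⟩
  · rintro ⟨γ, hγ, rfl⟩
    refine ⟨_, ⟨γ, hγ, rfl⟩, ?_⟩
    change g (γ (g.symm (g x))) = g (γ x)
    rw [Homeomorph.symm_apply_apply]
  · rintro ⟨_, ⟨γ, hγ, rfl⟩, h⟩
    refine ⟨γ, hγ, g.injective ?_⟩
    rw [← h]
    change g (γ x) = g (γ (g.symm (g x)))
    rw [Homeomorph.symm_apply_apply]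

/-- Invariance of a measure under a countable group depends only on the orbit equivalence relation. -/
theorem map_mem_invariantMeasures_of_forall_orbit [T2Space X] {Γ Λ : Subgroup (X ≃ₜ X)}
    (hΓ : Countable Γ) {g : X ≃ₜ X}
    (hg : ∀ x x', (∃ l ∈ Λ, l (g x) = g x') → ∃ γ ∈ Γ, γ x = x') {μ : Measure X}
    (hμ : μ ∈ invariantMeasures Γ) : μ.map g ∈ invariantMeasures Λ := by
  have := hμ.1
  refine ⟨Measure.isProbabilityMeasure_map g.measurable.aemeasurable, fun l hl => ?_⟩
  have h1 : μ.map (g⁻¹ * l * g : X ≃ₜ X) = μ := by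
    refine map_eq_of_forall_exists_apply_eq (S := Γ) (countable_coe_iff.1 hΓ)
      (fun γ hγ => hμ.2 γ hγ) _ fun x => ?_
    obtain ⟨γ, hγ, h⟩ := hg x ((g⁻¹ * l * g : X ≃ₜ X) x)
      ⟨l, hl, (g.apply_symm_apply (l (g x))).symm⟩
    exact ⟨γ, hγ, h.symm⟩
  conv_rhs => rw [← h1]
  rw [Measure.map_map l.measurable g.measurable,
    Measure.map_map g.measurable (Homeomorph.measurable _)]
  congr 1
  ext x
  exact (g.apply_symm_apply (l (g x))).symm

theorem image_map_invariantMeasures_eq_iff {Γ Λ : Subgroup (X ≃ₜ X)} {g : X ≃ₜ X} :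
    (fun μ => Measure.map g μ) '' invariantMeasures Γ = invariantMeasures Λ ↔
      (∀ μ ∈ invariantMeasures Γ, μ.map g ∈ invariantMeasures Λ) ∧
        ∀ ν ∈ invariantMeasures Λ, ν.map g.symm ∈ invariantMeasures Γ := by
  have h1 : ∀ μ : Measure X, (μ.map g).map g.symm = μ := fun μ => by
    rw [Measure.map_map g.symm.measurable g.measurable, Homeomorph.symm_comp_self, Measure.map_id]
  have h2 : ∀ μ : Measure X, (μ.map g.symm).map g = μ := fun μ => by
    rw [Measure.map_map g.measurable g.symm.measurable, Homeomorph.self_comp_symm, Measure.map_id]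
  constructor
  · intro h
    rw [← h]
    refine ⟨fun μ hμ => ⟨μ, hμ, rfl⟩, ?_⟩
    rintro _ ⟨μ, hμ, rfl⟩
    simpa only [h1] using hμ
  · rintro ⟨ha, hb⟩
    refine Subset.antisymm (image_subset_iff.2 ha) fun ν hν => ⟨_, hb ν hν, h2 ν⟩

theorem OrbitEquivalent.exists_image_map_eq [T2Space X] {Γ Λ : Subgroup (X ≃ₜ X)}
    (hΓ : Countable Γ) (hΛ : Countable Λ) (h : OrbitEquivalent Γ Λ) :
    ∃ g : X ≃ₜ X, (fun μ => Measure.map g μ) '' invariantMeasures Γ = invariantMeasures Λ := by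
  obtain ⟨g, hg⟩ := h
  refine ⟨g, image_map_invariantMeasures_eq_iff.2 ⟨fun μ hμ =>
    map_mem_invariantMeasures_of_forall_orbit hΓ (fun x x' => (hg x x').2) hμ, fun ν hν =>
    map_mem_invariantMeasures_of_forall_orbit hΛ (fun x x' h => ?_) hν⟩⟩
  have := (hg _ _).1 h
  rwa [Homeomorph.apply_symm_apply, Homeomorph.apply_symm_apply] at this

end Invariance

theorem theoremt {X : Type*} [TopologicalSpace X] [Nonempty X] [CompactSpace X]
    [TopologicalSpace.MetrizableSpace X] [TotallyDisconnectedSpace X] [PerfectSpace X]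
    [MeasurableSpace X] [BorelSpace X]
    (Γ Λ : Subgroup (X ≃ₜ X))
    (hΓ : IsAmple Γ) (hΓmin : ActsMinimally Γ) (hΓsat : IsSaturated Γ)
    (hΛ : IsAmple Λ) (hΛmin : ActsMinimally Λ) (hΛsat : IsSaturated Λ) :
    (OrbitEquivalent Γ Λ ↔
      ∃ g : X ≃ₜ X, (fun μ => Measure.map g μ) '' invariantMeasures Γ = invariantMeasures Λ) ∧
    (AreConjugate Γ Λ ↔
      ∃ g : X ≃ₜ X, (fun μ => Measure.map g μ) '' invariantMeasures Γ = invariantMeasures Λ) := by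
  let := TopologicalSpace.metrizableSpaceMetric X
  have hmeas : OrbitEquivalent Γ Λ → ∃ g : X ≃ₜ X,
      (fun μ => Measure.map g μ) '' invariantMeasures Γ = invariantMeasures Λ :=
    OrbitEquivalent.exists_image_map_eq hΓ.countable hΛ.countable
  have hconj : (∃ g : X ≃ₜ X,
      (fun μ => Measure.map g μ) '' invariantMeasures Γ = invariantMeasures Λ) →
      AreConjugate Γ Λ := by
    rintro ⟨g, hg⟩
    rw [image_map_invariantMeasures_eq_iff] at hg
    refine areConjugate_of_isPartialConj (g := g)
      ⟨inferInstance, bot_le, fun h hh => ?_, hg.1, hg.2⟩ hΓ hΛ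
      (fun A B hA hB hAB => hΓsat.exists_mem_of_measure_eq hΓ hΓmin hA hB hAB)
      (fun A B hA hB hAB => hΛsat.exists_mem_of_measure_eq hΛ hΛmin hA hB hAB)
    rw [Subgroup.mem_bot.1 hh, mul_one, mul_inv_cancel]
    exact Λ.one_mem
  exact ⟨⟨hmeas, fun h => (hconj h).orbitEquivalent⟩,
    ⟨fun h => hmeas h.orbitEquivalent, hconj⟩⟩
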